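/- **Theorem (discrete orthogonality of the ten types of orbit functions).** *Setting.* Let $V$ be a Euclidean space of dimension $n$ with scalar product $\langle\cdot,\cdot\rangle$, and let $\Pi\subset V$ be an irreducible reduced crystallographic root system spanning $V$, with simple roots $\Delta=\{\alpha_1,\dots,\alpha_n\}$. For $\alpha\in\Pi$ put $\alpha^\vee=2\alpha/\langle\alpha,\alpha\rangle$, and let $\Pi^\vee=\{\alpha^\vee:\alpha\in\Pi\}$, $\Delta^\vee=\{\alpha^\vee:\alpha\in\Delta\}$. Let $Q=\mathbb Z\Delta$, $Q^\vee=\mathbb Z\Delta^\vee$, let $P=\{x\in V:\langle x,y\rangle\in\mathbb Z\ \forall y\in Q^\vee\}$ and $P^\vee=\{x\in V:\langle x,y\rangle\in\mathbb Z\ \forall y\in Q\}$, and let $c=\det(\langle\alpha_i,\alpha_j^\vee\rangle)_{i,j}$. Let $\xi$ be the highest root of $\Pi$ with respect to $\Delta$ and $\eta$ the highest root of $\Pi^\vee$ with respect to $\Delta^\vee$. Let $W$ be the Weyl group, generated by the reflections $r_\alpha$, $\alpha\in\Delta$; let $W^{\mathrm{aff}}=Q^\vee\rtimes W$ and $\widehat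 W^{\mathrm{aff}}=Q\rtimes W$ be the groups of maps $x\mapsto wx+q$ with $w\in W$ and $q\in Q^\vee$, respectively $q\in Q$, and let $\psi$ denote in both cases the homomorphism onto $W$ that sends $x\mapsto wx+q$ to $w$. Let $R\subset W^{\mathrm{aff}}$ consist of the $r_\alpha$, $\alpha\in\Delta$, and of $r_0\colon x\mapsto r_\xi x+2\xi/\langle\xi,\xi\rangle$; let $R^\vee\subset\widehat W^{\mathrm{aff}}$ consist of the $r_\alpha$, $\alpha\in\Delta$, and of $r_0^\vee\colon x\mapsto r_\eta x+2\eta/\langle\eta,\eta\rangle$. Put $$F=\{a\in V:\langle a,\alpha\rangle\ge 0\ \forall\alpha\in\Delta,\ \langle a,\xi\rangle\le 1\},\qquad F^\vee=\{b\in V:\langle b,\alpha^\vee\rangle\ge 0\ \forall\alpha\in\Delta,\ \langle b,\eta\rangle\le 1\}.$$ *Even groups and domains.* Let $\widetilde\sigma,\sigma\colon W\to\{\pm1\}$ be homomorphisms and let $W^\sigma=\ker\sigma$, $W^{\mathrm{aff}}_\sigma=\{g\in W^{\mathrm{aff}}:\sigma(\psi(g))=1\}$ and $\widehat W^{\mathrm{aff}}_\sigma=\{g\in\widehat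 W^{\mathrm{aff}}:\sigma(\psi(g))=1\}$. Let $F^\sigma$ be the set of all $a\in F$ with $\sigma(\psi(\mathrm{Stab}_{W^{\mathrm{aff}}}(a)))=\{1\}$. If $\sigma$ is nontrivial, choose any $r_\sigma\in R$ with $\sigma(\psi(r_\sigma))=-1$ and put $D=F\cup r_\sigma F^\sigma$; if $\sigma$ is trivial, put $D=F$. Let $F^{\widetilde\sigma,\sigma}$ be the set of those $a\in D$ for which $\widetilde\sigma(\psi(\mathrm{Stab}_{W^{\mathrm{aff}}_\sigma}(a)))\ne\{\pm1\}$. Define $F^{\vee\widetilde\sigma,\sigma}$ in the same way from $F^\vee$, $\widehat W^{\mathrm{aff}}$, $\widehat W^{\mathrm{aff}}_\sigma$ and any choice of $r^\vee_\sigma\in R^\vee$ with $\sigma(\psi(r_\sigma^\vee))=-1$ (when $\sigma$ is nontrivial). For an integer $M\ge 1$ let $$F_M^{\widetilde\sigma,\sigma}=\tfrac1M P^\vee\cap F^{\widetilde\sigma,\sigma},\qquad \Lambda_M^{\widetilde\sigma,\sigma}=P\cap M F^{\vee\widetilde\sigma,\sigma},$$ $$\epsilon^\sigma(a)=\frac{|W^\sigma|}{|\mathrm{Stab}_{W^{\mathrm{aff}}_\sigma}(a)|},\qquad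 h_M^{\vee\sigma}(b)=\bigl|\mathrm{Stab}_{\widehat W^{\mathrm{aff}}_\sigma}(b/M)\bigr|,\qquad \Psi_b^{\widetilde\sigma,\sigma}(a)=\sum_{w\in W^\sigma}\widetilde\sigma(w)\,e^{2\pi i\langle wb,a\rangle}.$$ *Claim.* The set $F_M^{\widetilde\sigma,\sigma}$ is finite, and for all $b,b'\in\Lambda_M^{\widetilde\sigma,\sigma}$ $$\sum_{a\in F_M^{\widetilde\sigma,\sigma}}\epsilon^\sigma(a)\,\Psi_b^{\widetilde\sigma,\sigma}(a)\,\overline{\Psi_{b'}^{\widetilde\sigma,\sigma}(a)}=c\,|W^\sigma|\,M^n\,h_M^{\vee\sigma}(b)\,\delta_{b,b'}.$$ -/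

import Mathlib

open scoped Pointwise InnerProductSpace

noncomputable section

namespace EvenOrbit

/-! ### Affine groups `L ⋊ W` acting on a Euclidean space -/

section Affine

variable {V : Type*} [NormedAddCommGroup V] [InnerProductSpace ℝ V]
variable {W : Subgroup (V ≃ₗ[ℝ] V)} {L : AddSubgroup V}

/-- The group `L ⋊ W` of all affine maps `a ↦ w a + q` with `w ∈ W` and `q ∈ L`, where `L` is a
`W`-stable additive subgroup. -/
def affineGroup (hL : ∀ w ∈ W, ∀ x ∈ L, w x ∈ L) : Subgroup (V ≃ᵃ[ℝ] V) where
  carrier := {g | g.linear ∈ W ∧ g 0 ∈ L}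
  one_mem' := ⟨W.one_mem, L.zero_mem⟩
  mul_mem' := by
    rintro g h ⟨hg, hg'⟩ ⟨hh, hh'⟩
    refine ⟨W.mul_mem hg hh, ?_⟩
    have h1 : (g * h) 0 = g.linear (h 0) + g 0 := by
      have := g.map_vadd 0 (h 0)
      simpa using this
    rw [h1]
    exact L.add_mem (hL _ hg _ hh') hg'
  inv_mem' := by
    rintro g ⟨hg, hg'⟩
    have hi : g⁻¹.linear ∈ W := W.inv_mem hg
    refine ⟨hi, ?_⟩
    have h1 : g⁻¹ 0 = -(g⁻¹.linear (g 0)) := by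
      have h2 := (g⁻¹).map_vadd 0 (g 0)
      have h3 : g⁻¹ (g 0) = 0 := g.symm_apply_apply 0
      simp only [vadd_eq_add, add_zero, h3] at h2
      exact eq_neg_of_add_eq_zero_right h2.symm
    rw [h1]
    exact L.neg_mem (hL _ hi _ hg')

variable (hL : ∀ w ∈ W, ∀ x ∈ L, w x ∈ L)

/-- The retraction homomorphism `ψ : L ⋊ W → W`, sending `a ↦ w a + q` to `w`. -/
def retraction : affineGroup hL →* W where
  toFun g := ⟨g.1.linear, g.2.1⟩
  map_one' := rfl
  map_mul' _ _ := rfl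

/-- The even affine group `L ⋊ W^σ`, the kernel of `σ ∘ ψ`. -/
def evenAffineGroup (σ : W →* ℤˣ) : Subgroup (affineGroup hL) :=
  (σ.comp (retraction hL)).ker

/-- The isotropy group of the point `a` in the even affine group `L ⋊ W^σ`. -/
def evenStab (σ : W →* ℤˣ) (a : V) : Set (affineGroup hL) :=
  {g | g ∈ evenAffineGroup hL σ ∧ g.1 a = a}

/-- The orthogonal reflection `x ↦ x - 2 ⟨x, α⟩ / ⟨α, α⟩ α`. -/
def orthReflection (α x : V) : V := x - (2 * ⟪x, α⟫_ℝ / ⟪α, α⟫_ℝ) • α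

/-- `θ` is the highest element of `roots` for the partial order in which `ν ≤ μ` iff `μ - ν` is a
combination of elements of `simple` with nonnegative integer coefficients. -/
def IsHighest (roots simple : Set V) (θ : V) : Prop :=
  θ ∈ roots ∧ ∀ β ∈ roots, θ - β ∈ AddSubmonoid.closure simple

/-- The set `R` of generators of the affine Weyl group: the reflections in the simple roots and
the affine reflection `a ↦ r_θ a + 2 θ / ⟨θ, θ⟩`, where `θ` is the highest root. -/
def generators (roots simple : Set V) : Set (V ≃ᵃ[ℝ] V) :=
  {g | (∃ α ∈ simple, ∀ a, g a = orthReflection α a) ∨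
    ∃ θ, IsHighest roots simple θ ∧ ∀ a, g a = orthReflection θ a + (2 / ⟪θ, θ⟫_ℝ) • θ}

/-- The set `R^σ` of those generators `r` for which `σ (ψ r) = -1`. -/
def negGenerators (roots simple : Set V) (σ : W →* ℤˣ) : Set (affineGroup hL) :=
  {g | g.1 ∈ generators roots simple ∧ σ (retraction hL g) = -1}

/-- The closed fundamental simplex: `⟨a, α⟩ ≥ 0` for all simple roots `α` and `⟨a, θ⟩ ≤ 1` for
the highest root `θ`. -/
def simplex (roots simple : Set V) : Set V :=
  {a | (∀ α ∈ simple, 0 ≤ ⟪a, α⟫_ℝ) ∧ ∀ θ, IsHighest roots simple θ → ⟪a, θ⟫_ℝ ≤ 1}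

/-- The set `F^σ` of the points `a ∈ F` for which `σ ∘ ψ` takes only the value `1` on the isotropy
group of `a` in the full group `L ⋊ W`. -/
def signDomain (F : Set V) (σ : W →* ℤˣ) : Set V :=
  {a ∈ F | (fun g => σ (retraction hL g)) '' evenStab hL 1 a = {1}}

open Classical in
/-- The set `F ∪ r F^σ`; for the trivial `σ`, where there are no negative generators, it is `F`. -/
def evenDomain (F : Set V) (σ : W →* ℤˣ) (r : affineGroup hL) : Set V :=
  F ∪ if σ = 1 then ∅ else r.1 '' signDomain hL F σ

/-- The set `H^{τ,σ}` of the points `a` of `F ∪ r F^σ` for which `τ ∘ ψ` takes both values `1`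
and `-1` on the isotropy group of `a` in `L ⋊ W^σ`. -/
def boundary (F : Set V) (τ σ : W →* ℤˣ) (r : affineGroup hL) : Set V :=
  {a ∈ evenDomain hL F σ r | (fun g => τ (retraction hL g)) '' evenStab hL σ a = {1, -1}}

/-- The set `F^{τ,σ} = (F ∪ r F^σ) \ H^{τ,σ}`. -/
def domain (F : Set V) (τ σ : W →* ℤˣ) (r : affineGroup hL) : Set V :=
  evenDomain hL F σ r \ boundary hL F τ σ r

end Affine

/-! ### Euclidean root systems, their lattices and their affine Weyl groups -/

section Root

variable {ι V N : Type*} [NormedAddCommGroup V] [InnerProductSpace ℝ V]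
  [AddCommGroup N] [Module ℝ N]

/-- The reflections of the root system are orthogonal with respect to the scalar product of the
ambient space. -/
class IsEuclidean (P : RootPairing ι ℝ V N) : Prop where
  inner_reflection (i : ι) (x y : V) : ⟪P.reflection i x, P.reflection i y⟫_ℝ = ⟪x, y⟫_ℝ

/-- The dual root `α^∨ = 2 α / ⟨α, α⟩`, as a vector of the Euclidean space `V`. -/
def dualRoot (P : RootPairing ι ℝ V N) (i : ι) : V :=
  (2 / ⟪P.root i, P.root i⟫_ℝ) • P.root i

lemma toLinearMap_coroot (P : RootPairing ι ℝ V N) [IsEuclidean P] (i : ι) (x : V) :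
    P.coroot' i x = ⟪x, dualRoot P i⟫_ℝ := by
  have h := IsEuclidean.inner_reflection (P := P) i x (P.root i)
  have h0 : ⟪P.root i, P.root i⟫_ℝ ≠ 0 := inner_self_ne_zero.mpr (P.ne_zero i)
  rw [P.reflection_apply_self, P.reflection_apply, inner_neg_right, inner_sub_left,
    real_inner_smul_left] at h
  rw [dualRoot, real_inner_smul_right]
  field_simp
  linarith

variable {P : RootPairing ι ℝ V N} (b : P.Base)

/-- The set of simple roots `Δ`. -/
def simpleRoots : Set V := P.root '' b.support

/-- The set of simple dual roots `Δ^∨`. -/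
def simpleDualRoots : Set V := dualRoot P '' b.support

/-- The Weyl group, generated by the reflections in the simple roots. -/
def weylGroup : Subgroup (V ≃ₗ[ℝ] V) := Subgroup.closure (P.reflection '' b.support)

/-- The root lattice `Q`. -/
def rootLattice : AddSubgroup V := AddSubgroup.closure (simpleRoots b)

/-- The dual root lattice `Q^∨`. -/
def dualRootLattice : AddSubgroup V := AddSubgroup.closure (simpleDualRoots b)

/-- The weight lattice `P`, dual over `ℤ` to `Q^∨`. -/
def weightLattice : Set V := {x | ∀ y ∈ dualRootLattice b, ∃ k : ℤ, ⟪x, y⟫_ℝ = k}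

/-- The dual weight lattice `P^∨`, dual over `ℤ` to `Q`. -/
def dualWeightLattice : Set V := {x | ∀ y ∈ rootLattice b, ∃ k : ℤ, ⟪x, y⟫_ℝ = k}

/-- The index of connection `c`, the determinant of the Cartan matrix. -/
def connectionIndex [P.IsCrystallographic] : ℤ :=
  letI := Classical.decEq ι
  b.cartanMatrix.det

lemma stable_of_simple {S : Set V}
    (h : ∀ i ∈ b.support, ∀ x ∈ S, P.reflection i x ∈ AddSubgroup.closure S) :
    ∀ w ∈ weylGroup b, ∀ x ∈ AddSubgroup.closure S, w x ∈ AddSubgroup.closure S := by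
  have key : ∀ i ∈ b.support, ∀ x ∈ AddSubgroup.closure S,
      P.reflection i x ∈ AddSubgroup.closure S := by
    intro i hi x hx
    induction hx using AddSubgroup.closure_induction with
    | mem x hx => exact h i hi x hx
    | zero => simp
    | add x y _ _ hx hy => rw [map_add]; exact AddSubgroup.add_mem _ hx hy
    | neg x _ hx => rw [map_neg]; exact AddSubgroup.neg_mem _ hx
  intro w hw
  induction hw using Subgroup.closure_induction'' with
  | mem w hw =>
    obtain ⟨i, hi, rfl⟩ := hw
    exact key i hi
  | inv_mem w hw =>
    obtain ⟨i, hi, rfl⟩ := hw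
    rw [P.reflection_inv]
    exact key i hi
  | one => exact fun x hx => hx
  | mul w w' _ _ h1 h2 => exact fun x hx => h1 _ (h2 _ hx)

variable [P.IsCrystallographic]

lemma rootLattice_stable : ∀ w ∈ weylGroup b, ∀ x ∈ rootLattice b, w x ∈ rootLattice b := by
  refine stable_of_simple b ?_
  rintro i hi - ⟨j, hj, rfl⟩
  obtain ⟨k, hk⟩ := P.exists_value (S := ℤ) j i
  rw [P.reflection_apply_root, ← hk]
  refine AddSubgroup.sub_mem _ (AddSubgroup.subset_closure ⟨j, hj, rfl⟩) ?_
  have : algebraMap ℤ ℝ k • P.root i = k • P.root i := Int.cast_smul_eq_zsmul ℝ k (P.root i)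
  rw [this]
  exact AddSubgroup.zsmul_mem _ (AddSubgroup.subset_closure (Set.mem_image_of_mem _ hi)) k

lemma dualRootLattice_stable [IsEuclidean P] :
    ∀ w ∈ weylGroup b, ∀ x ∈ dualRootLattice b, w x ∈ dualRootLattice b := by
  refine stable_of_simple b ?_
  rintro i hi - ⟨j, hj, rfl⟩
  obtain ⟨k, hk⟩ := P.exists_value (S := ℤ) i j
  have h1 : P.pairing i j = ⟪P.root i, dualRoot P j⟫_ℝ := toLinearMap_coroot P j (P.root i)
  have h2 : P.reflection i (dualRoot P j) = dualRoot P j - k • dualRoot P i := by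
    rw [P.reflection_apply, toLinearMap_coroot]
    have h3 : (k : ℝ) = ⟪P.root i, dualRoot P j⟫_ℝ := by rw [← h1, ← hk]; simp
    rw [← Int.cast_smul_eq_zsmul ℝ, h3]
    congr 1
    simp only [dualRoot, real_inner_smul_left, real_inner_smul_right, smul_smul]
    rw [real_inner_comm (P.root i) (P.root j)]
    congr 1
    ring
  rw [h2]
  exact AddSubgroup.sub_mem _ (AddSubgroup.subset_closure ⟨j, hj, rfl⟩)
    (AddSubgroup.zsmul_mem _ (AddSubgroup.subset_closure (Set.mem_image_of_mem _ hi)) k)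

/-- The affine Weyl group `W^aff = Q^∨ ⋊ W`. -/
abbrev affineWeylGroup [IsEuclidean P] : Subgroup (V ≃ᵃ[ℝ] V) :=
  affineGroup (dualRootLattice_stable b)

/-- The dual affine Weyl group `Q ⋊ W`. -/
abbrev dualAffineWeylGroup : Subgroup (V ≃ᵃ[ℝ] V) :=
  affineGroup (rootLattice_stable b)

end Root

section Orbit

variable {ι V N : Type*} [NormedAddCommGroup V] [InnerProductSpace ℝ V]
  [AddCommGroup N] [Module ℝ N] {P : RootPairing ι ℝ V N} (b : P.Base)

lemma weylGroup_mem_range : ∀ w ∈ weylGroup b, ∀ i, w (P.root i) ∈ Set.range P.root := by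
  intro w hw
  induction hw using Subgroup.closure_induction'' with
  | mem w hw =>
    obtain ⟨i, hi, rfl⟩ := hw
    exact fun j => P.mapsTo_reflection_root i ⟨j, rfl⟩
  | inv_mem w hw =>
    obtain ⟨i, hi, rfl⟩ := hw
    rw [P.reflection_inv]
    exact fun j => P.mapsTo_reflection_root i ⟨j, rfl⟩
  | one => exact fun j => ⟨j, rfl⟩
  | mul w w' _ _ h1 h2 =>
    intro j
    obtain ⟨k, hk⟩ := h2 j
    change w (w' (P.root j)) ∈ _
    rw [← hk]
    exact h1 k

instance finite_weylGroup [Finite ι] [P.IsRootSystem] : Finite (weylGroup b) := by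
  have hf : Finite (Set.range P.root) := Set.finite_range P.root
  refine Finite.of_injective
    (fun (w : weylGroup b) (i : ι) =>
      (⟨w.1 (P.root i), weylGroup_mem_range b w.1 w.2 i⟩ : Set.range P.root)) ?_
  intro w w' h
  apply Subtype.ext
  apply LinearEquiv.toLinearMap_injective
  refine LinearMap.ext_on_range (v := P.root) RootPairing.IsRootSystem.span_root_eq_top ?_
  intro i
  exact congrArg Subtype.val (congrFun h i)

/-- The orbit function `Ψ_β^{τ,σ}(a) = ∑_{w ∈ W^σ} τ(w) exp(2πi ⟨wβ, a⟩)`, where `W^σ` is the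
kernel of `σ`. -/
def orbitFunction [Finite ι] [P.IsRootSystem] (τ σ : weylGroup b →* ℤˣ) (β a : V) : ℂ :=
  letI := Fintype.ofFinite σ.ker
  ∑ w : σ.ker, (((τ w.1 : ℤˣ) : ℤ) : ℂ) *
    Complex.exp (2 * Real.pi * Complex.I * ((⟪w.1.1 β, a⟫_ℝ : ℝ) : ℂ))

variable [P.IsCrystallographic]

/-- The weight `ε^σ(a) = |W^σ| / h^σ(a)`, where `h^σ(a)` is the order of the isotropy group of `a`
in `Q^∨ ⋊ W^σ`. -/
def orbitWeight [IsEuclidean P] (σ : weylGroup b →* ℤˣ) (a : V) : ℝ :=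
  (Nat.card σ.ker : ℝ) / (Nat.card (evenStab (dualRootLattice_stable b) σ a) : ℝ)

/-- The number `h_M^{∨σ}(β)`, the order of the isotropy group of `β / M` in `Q ⋊ W^σ`. -/
def dualStabOrder (σ : weylGroup b →* ℤˣ) (M : ℕ) (β : V) : ℕ :=
  Nat.card (evenStab (rootLattice_stable b) σ ((M : ℝ)⁻¹ • β))

/-- The set `R^σ` of the negative generators of the affine Weyl group. -/
def negReflections [IsEuclidean P] (σ : weylGroup b →* ℤˣ) : Set (affineWeylGroup b) :=
  negGenerators (dualRootLattice_stable b) (Set.range P.root) (simpleRoots b) σ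

/-- The set `R^{∨σ}` of the negative generators of the dual affine Weyl group. -/
def dualNegReflections (σ : weylGroup b →* ℤˣ) : Set (dualAffineWeylGroup b) :=
  negGenerators (rootLattice_stable b) (Set.range (dualRoot P)) (simpleDualRoots b) σ

/-- The point set `F_M^{τ,σ} = (1/M) P^∨ ∩ F^{τ,σ}`. -/
def pointSet [IsEuclidean P] (τ σ : weylGroup b →* ℤˣ) (r : affineWeylGroup b) (M : ℕ) : Set V :=
  ((M : ℝ)⁻¹ • dualWeightLattice b) ∩
    domain (dualRootLattice_stable b) (simplex (Set.range P.root) (simpleRoots b)) τ σ r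

/-- The label set `Λ_M^{τ,σ} = P ∩ M F^{∨τ,σ}`. -/
def labelSet (τ σ : weylGroup b →* ℤˣ) (r : dualAffineWeylGroup b) (M : ℕ) : Set V :=
  weightLattice b ∩ ((M : ℝ) •
    domain (rootLattice_stable b) (simplex (Set.range (dualRoot P)) (simpleDualRoots b)) τ σ r)

/-- The scalar product `⟨f, g⟩ = ∑_{a ∈ S} ε(a) f(a) conj (g(a))` on a finite set `S`. -/
def weightedProduct (S : Set V) (ε : V → ℝ) (f g : V → ℂ) : ℂ :=
  ∑ᶠ a ∈ S, (ε a : ℂ) * f a * (starRingEnd ℂ) (g a)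

end Orbit

end EvenOrbit

end

open scoped Pointwise InnerProductSpace

set_option linter.unusedSectionVars false

noncomputable section

namespace EvenOrbit

/-! ### Heights and the highest root -/

section HighestRoot

variable {ι V N : Type*} [NormedAddCommGroup V] [InnerProductSpace ℝ V]
  [AddCommGroup N] [Module ℝ N]

/-! The theorem is orthogonality of characters on the finite group X/Q^∨, where X = (1/M)P^∨, folded
by W^σ. The product of one orbit function with the conjugate of another is invariant under Q^∨ ⋊
W^σ, since both factors change by the same sign. The set F ∪ r F^σ meets every orbit once, and
ε^σ(a) is the size of the orbit of a modulo Q^∨. On the deleted boundary the orbit functions vanish,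
so the weighted sum is the plain sum over X/Q^∨ (`sum_strictDomain_eq_sum_quotient`).

Expanding the product gives characters with weights wβ - w'β'. By `sum_expTwoPi_inner` such a
character contributes |X/Q^∨| = c M^n (`relIndex_dualRootLattice`) if its weight lies in MQ, and 0
otherwise. After the substitution w' = wu the condition says that β/M and uβ'/M agree modulo Q. Both
β/M and β'/M lie in a strict fundamental domain of Q ⋊ W^σ, so this forces β = β'. Then u runs over
the image of an isotropy group, on which τ is 1 because the dual boundary was deleted.

The geometric input is that F is a strict fundamental domain of the affine Weyl group. Existence
(`exists_mem_simplex`) comes from the orbit point nearest to an interior point of F, uniqueness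
(`eq_of_mem_simplex`) from deleting letters in a word of simple affine reflections; both use the
highest root (`exists_isHighest`). The dual simplex is treated by passing to the dual root system,
and `IsStrictDomain.evenDomain` passes to the even groups by following signs. -/

lemma pairing_eq_inner_dualRoot (P : RootPairing ι ℝ V N) [IsEuclidean P] (i j : ι) :
    P.pairing i j = ⟪P.root i, dualRoot P j⟫_ℝ :=
  toLinearMap_coroot P j (P.root i)

lemma inner_root_self_pos (P : RootPairing ι ℝ V N) (i : ι) :
    0 < ⟪P.root i, P.root i⟫_ℝ :=
  real_inner_self_pos.mpr (P.ne_zero i)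

lemma inner_root_eq (P : RootPairing ι ℝ V N) [IsEuclidean P] (i j : ι) :
    ⟪P.root i, P.root j⟫_ℝ = P.pairing i j * (⟪P.root j, P.root j⟫_ℝ / 2) := by
  rw [pairing_eq_inner_dualRoot, dualRoot, real_inner_smul_right]
  have := (inner_root_self_pos P j).ne'
  field_simp

lemma pairingIn_pos_iff (P : RootPairing ι ℝ V N) [IsEuclidean P] [P.IsCrystallographic]
    (i j : ι) : 0 < P.pairingIn ℤ i j ↔ 0 < ⟪P.root i, P.root j⟫_ℝ := by
  rw [inner_root_eq, mul_pos_iff_of_pos_right (half_pos (inner_root_self_pos P j)),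
    ← P.algebraMap_pairingIn ℤ]
  simp

lemma pairingIn_nonneg_iff (P : RootPairing ι ℝ V N) [IsEuclidean P] [P.IsCrystallographic]
    (i j : ι) : 0 ≤ P.pairingIn ℤ i j ↔ 0 ≤ ⟪P.root i, P.root j⟫_ℝ := by
  rw [inner_root_eq, mul_nonneg_iff_of_pos_right (half_pos (inner_root_self_pos P j)),
    ← P.algebraMap_pairingIn ℤ]
  simp

variable {P : RootPairing ι ℝ V N} (b : P.Base)

lemma finiteDimensional_of_base {P : RootPairing ι ℝ V N} (b : P.Base) [P.IsRootSystem] : FiniteDimensional ℝ V :=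
  Module.Basis.finiteDimensional_of_finite b.toWeightBasis

/-- There is a vector with prescribed scalar products with the simple roots. -/
lemma exists_inner_simple_eq [P.IsRootSystem] (f : b.support → ℝ) :
    ∃ v : V, ∀ i : b.support, ⟪P.root i, v⟫_ℝ = f i := by
  have := finiteDimensional_of_base b
  have : CompleteSpace V := FiniteDimensional.complete ℝ V
  refine ⟨(InnerProductSpace.toDual ℝ V).symm
    (LinearMap.toContinuousLinearMap (b.toWeightBasis.constr ℝ f)), fun i => ?_⟩
  rw [real_inner_comm, InnerProductSpace.toDual_symm_apply]
  have := b.toWeightBasis.constr_basis ℝ f i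
  rw [b.toWeightBasis_apply] at this
  simpa using this

/-- Turns the combinatorial height into a linear functional, so that inequalities in the closure of
the simple roots can be read off from scalar products. -/
lemma exists_inner_root_eq_height [P.IsRootSystem] :
    ∃ ρ : V, ∀ i, ⟪P.root i, ρ⟫_ℝ = b.height i := by
  obtain ⟨ρ, hρ⟩ := exists_inner_simple_eq b (fun _ => 1)
  refine ⟨ρ, fun i => ?_⟩
  obtain ⟨f, -, -, hf⟩ := b.exists_root_eq_sum_int i
  rw [RootPairing.Base.height_eq_sum hf, hf, sum_inner, Int.cast_sum]
  refine Finset.sum_congr rfl fun j hj => ?_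
  rw [← Int.cast_smul_eq_zsmul ℝ, real_inner_smul_left, hρ ⟨j, hj⟩, mul_one]

lemma inner_nonneg_of_mem_closure {S : Set V} {v x : V} (h : ∀ y ∈ S, 0 ≤ ⟪y, v⟫_ℝ)
    (hx : x ∈ AddSubmonoid.closure S) : 0 ≤ ⟪x, v⟫_ℝ := by
  induction hx using AddSubmonoid.closure_induction with
  | mem x hx => exact h x hx
  | zero => simp
  | add x y _ _ hx hy => rw [inner_add_left]; exact add_nonneg hx hy

lemma height_le_of_sub_mem_closure [P.IsRootSystem] {i j : ι}
    (h : P.root i - P.root j ∈ AddSubmonoid.closure (simpleRoots b)) :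
    b.height j ≤ b.height i := by
  obtain ⟨ρ, hρ⟩ := exists_inner_root_eq_height b
  have := inner_nonneg_of_mem_closure (v := ρ) (by
    rintro - ⟨k, hk, rfl⟩
    rw [hρ, RootPairing.Base.height_one_of_mem_support hk]; simp) h
  rw [inner_sub_left, hρ, hρ, sub_nonneg] at this
  exact_mod_cast this

lemma isPos_iff_mem_closure [P.IsRootSystem] (i : ι) :
    b.IsPos i ↔ P.root i ∈ AddSubmonoid.closure (simpleRoots b) := by
  obtain ⟨ρ, hρ⟩ := exists_inner_root_eq_height b
  have key : ∀ x ∈ AddSubmonoid.closure (simpleRoots b), 0 ≤ ⟪x, ρ⟫_ℝ := fun x hx =>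
    inner_nonneg_of_mem_closure (by
      rintro - ⟨k, hk, rfl⟩
      rw [hρ, RootPairing.Base.height_one_of_mem_support hk]; simp) hx
  have h0 := b.height_ne_zero i
  rw [RootPairing.Base.isPos_iff]
  constructor
  · intro h
    refine (b.root_mem_or_neg_mem i).resolve_right fun h' => ?_
    have := key _ h'
    rw [inner_neg_left, hρ, neg_nonneg] at this
    have : b.height i ≤ 0 := by exact_mod_cast this
    omega
  · intro h
    have := key _ h
    rw [hρ] at this
    have : 0 ≤ b.height i := by exact_mod_cast this
    omega

variable [Finite ι] [P.IsRootSystem] [P.IsCrystallographic]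

/-- A negative product with a simple root would make the sum a root, higher by one and still above
i. The sum fails to be a root only for i the negative of j, and then j itself lies above i. -/
lemma inner_simple_nonneg_of_maximal [IsEuclidean P] {i : ι}
    (hi : ∀ k, P.root k - P.root i ∈ AddSubmonoid.closure (simpleRoots b) →
      b.height k ≤ b.height i) {j : ι} (hj : j ∈ b.support) :
    0 ≤ ⟪P.root i, P.root j⟫_ℝ := by
  rw [← pairingIn_nonneg_iff]
  by_contra! hlt
  have hjm : P.root j ∈ AddSubmonoid.closure (simpleRoots b) :=
    AddSubmonoid.subset_closure ⟨j, hj, rfl⟩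
  have hj1 := RootPairing.Base.height_one_of_mem_support hj
  by_cases hneg : P.root i = -P.root j
  · have h1 := hi j (by rw [hneg, sub_neg_eq_add]; exact add_mem hjm hjm)
    have h2 : 0 < b.height i := by omega
    obtain ⟨ρ, hρ⟩ := exists_inner_root_eq_height b
    have h4 := hρ i
    rw [hneg, inner_neg_left, hρ, hj1] at h4
    have : (-1 : ℤ) = b.height i := by exact_mod_cast h4
    omega
  · obtain ⟨k, hk⟩ := P.root_add_root_mem_of_pairingIn_neg hlt hneg
    have h1 := hi k (by rw [hk, add_sub_cancel_left]; exact hjm)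
    have h2 := b.height_add hk
    omega

/-- If the coefficient at l vanishes, the products of the other terms with l are nonpositive and, by
dominance, have nonnegative sum, so each is zero. Hence l is orthogonal to every simple root with
positive coefficient, and connectedness of the Dynkin diagram excludes this. -/
lemma pos_coeff_of_dominant [P.IsReduced] [P.IsIrreducible] [IsEuclidean P] {i : ι}
    (hpos : b.IsPos i) (hi : ∀ j ∈ b.support, 0 ≤ ⟪P.root i, P.root j⟫_ℝ) :
    ∃ f : ι → ℤ, (∀ j ∈ b.support, 0 < f j) ∧ P.root i = ∑ j ∈ b.support, f j • P.root j := by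
  obtain ⟨f, hf0, hf, hsum⟩ := b.exists_root_eq_sum_int i
  refine ⟨f, ?_, hsum⟩
  have hfpos : 0 < f := by
    refine hf.resolve_right fun hneg => ?_
    have h1 := RootPairing.Base.height_eq_sum hsum
    have h2 : ∑ j ∈ b.support, f j ≤ 0 := Finset.sum_nonpos fun j _ => hneg.le j
    rw [RootPairing.Base.isPos_iff] at hpos
    omega
  obtain ⟨i₀, hi₀⟩ : ∃ i₀, 0 < f i₀ := (Pi.lt_def.mp hfpos).2
  have hi₀s : i₀ ∈ b.support := hf0 (by simpa using hi₀.ne')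
  intro j hj
  refine b.induction_on_cartanMatrix (fun j => 0 < f j) (i := ⟨i₀, hi₀s⟩) (j := ⟨j, hj⟩) hi₀ ?_
  rintro k l hk hkl
  have hk' : 0 < f k := hk
  change 0 < f l
  by_contra hl
  have hl0 : f l = 0 := le_antisymm (not_lt.mp hl) (hfpos.le l)
  have hle : ∀ m ∈ b.support, f m * ⟪P.root m, P.root l⟫_ℝ ≤ 0 := by
    intro m hm
    by_cases hml : m = l
    · rw [hml, hl0]; simp
    · have h1 := b.pairingIn_le_zero_of_ne hml hm l.2
      refine mul_nonpos_of_nonneg_of_nonpos (by exact_mod_cast hfpos.le m) ?_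
      rw [← not_lt, ← pairingIn_pos_iff, not_lt]
      exact h1
  have hsum0 : 0 ≤ ∑ m ∈ b.support, f m * ⟪P.root m, P.root l⟫_ℝ := by
    have := hi l l.2
    rw [hsum, sum_inner] at this
    refine this.trans_eq (Finset.sum_congr rfl fun m _ => ?_)
    rw [← Int.cast_smul_eq_zsmul ℝ, real_inner_smul_left]
  have hzero := (Finset.sum_eq_zero_iff_of_nonpos hle).mp
    (le_antisymm (Finset.sum_nonpos hle) hsum0) k k.2
  have hkl0 : ⟪P.root k, P.root l⟫_ℝ = 0 := by
    rcases mul_eq_zero.mp hzero with h | h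
    · exact absurd (by exact_mod_cast h) hk'.ne'
    · exact h
  have hlk0 : ⟪P.root l, P.root k⟫_ℝ = 0 := by rw [real_inner_comm, hkl0]
  apply hkl
  rw [b.cartanMatrix_apply_eq_zero_iff_pairing, pairing_eq_inner_dualRoot, dualRoot,
    real_inner_smul_right, hlk0, mul_zero]

/-- An irreducible root system has a highest root. -/
theorem exists_isHighest [P.IsReduced] [P.IsIrreducible] [IsEuclidean P] :
    ∃ i, IsHighest (Set.range P.root) (simpleRoots b) (P.root i) := by
  have := RootPairing.IsIrreducible.nontrivial P
  have : Nonempty ι := by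
    by_contra h
    rw [not_nonempty_iff] at h
    have h1 := RootPairing.IsRootSystem.span_root_eq_top (P := P)
    rw [Set.range_eq_empty, Submodule.span_empty] at h1
    exact bot_ne_top h1
  obtain ⟨i, hi⟩ := Finite.exists_max b.height
  refine ⟨i, ⟨i, rfl⟩, ?_⟩
  rintro - ⟨j, rfl⟩
  -- A highest element k above j is compared with the globally highest i; once they coincide, i lies
  -- above j.
  obtain ⟨k, hkj, hk⟩ := Set.exists_max_image
    {k | P.root k - P.root j ∈ AddSubmonoid.closure (simpleRoots b)} b.height (Set.toFinite _)
    ⟨j, by simp⟩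
  have hkmax : ∀ l, P.root l - P.root k ∈ AddSubmonoid.closure (simpleRoots b) →
      b.height l ≤ b.height k := by
    intro l hl
    refine hk l ?_
    have := add_mem hl hkj
    rwa [sub_add_sub_cancel] at this
  suffices i = k by rw [this]; exact hkj
  by_contra hik
  have hki : k ≠ i := fun h => hik h.symm
  have hipos : b.IsPos i := by
    obtain ⟨s, hs⟩ := b.support_nonempty
    have h1 := hi s
    rw [RootPairing.Base.height_one_of_mem_support hs] at h1
    rw [RootPairing.Base.isPos_iff]
    omega
  obtain ⟨f, hfpos, hf⟩ := pos_coeff_of_dominant b hipos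
    (fun s hs => inner_simple_nonneg_of_maximal b (fun l _ => hi l) hs)
  have hkdom : ∀ s ∈ b.support, 0 ≤ ⟪P.root k, P.root s⟫_ℝ :=
    fun s hs => inner_simple_nonneg_of_maximal b hkmax hs
  have hsum : ⟪P.root k, P.root i⟫_ℝ = ∑ s ∈ b.support, f s * ⟪P.root k, P.root s⟫_ℝ := by
    rw [hf, inner_sum]
    refine Finset.sum_congr rfl fun m _ => ?_
    rw [← Int.cast_smul_eq_zsmul ℝ, real_inner_smul_right]
  have hterm : ∀ s ∈ b.support, 0 ≤ (f s : ℝ) * ⟪P.root k, P.root s⟫_ℝ := fun s hs =>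
    mul_nonneg (by exact_mod_cast (hfpos s hs).le) (hkdom s hs)
  have hpos : 0 < ⟪P.root k, P.root i⟫_ℝ := by
    rw [hsum]
    refine (Finset.sum_nonneg hterm).lt_of_ne' fun h0 => ?_
    have h1 := (Finset.sum_eq_zero_iff_of_nonneg hterm).mp h0
    have h2 : ∀ s ∈ b.support, ⟪P.root k, P.root s⟫_ℝ = 0 := fun s hs =>
      (mul_eq_zero.mp (h1 s hs)).resolve_left (by exact_mod_cast (hfpos s hs).ne')
    obtain ⟨g, -, -, hg⟩ := b.exists_root_eq_sum_int k
    refine (inner_root_self_pos P k).ne' ?_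
    calc ⟪P.root k, P.root k⟫_ℝ = ⟪P.root k, ∑ s ∈ b.support, g s • P.root s⟫_ℝ := by rw [← hg]
      _ = 0 := by
        rw [inner_sum]
        refine Finset.sum_eq_zero fun s hs => ?_
        rw [← Int.cast_smul_eq_zsmul ℝ, real_inner_smul_right, h2 s hs, mul_zero]
  -- The difference k - i would be a root. If positive, k is higher than i; if negative, i lies
  -- above k, so both have the same height and the root l has height zero.
  obtain ⟨l, hl⟩ := P.root_sub_root_mem_of_pairingIn_pos ((pairingIn_pos_iff P k i).mpr hpos) hki
  have hlh := b.height_sub hl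
  have h1 := hi k
  have h0 := b.height_ne_zero l
  rcases b.root_mem_or_neg_mem l with h | h
  · have := (isPos_iff_mem_closure b l).mpr h
    rw [RootPairing.Base.isPos_iff] at this
    omega
  · rw [hl, neg_sub] at h
    have := hkmax i h
    omega

end HighestRoot

/-! ### Affine roots and words in affine reflections -/

section AffineRoots

variable {ι V N : Type*} [NormedAddCommGroup V] [InnerProductSpace ℝ V]
  [AddCommGroup N] [Module ℝ N] (P : RootPairing ι ℝ V N)

/-- The affine root `x ↦ ⟨x, α⟩ + k`, for `α` a root and `k` an integer. -/
def affineRoot (a : ι × ℤ) (x : V) : ℝ := ⟪x, P.root a.1⟫_ℝ + a.2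

/-- The reflection in the zero set of an affine root. -/
def affineReflection (a : ι × ℤ) (x : V) : V := x - affineRoot P a x • dualRoot P a.1

/-- The composite of the affine root `a` with the reflection in the affine root `s`. -/
def reflectAffineRoot [P.IsCrystallographic] (s a : ι × ℤ) : ι × ℤ :=
  (P.reflectionPerm s.1 a.1, a.2 - s.2 * P.pairingIn ℤ a.1 s.1)

/-- The composite of a list of reflections in affine roots. -/
def composeReflections (l : List (ι × ℤ)) (x : V) : V := l.foldr (affineReflection P) x

@[simp] lemma composeReflections_nil (x : V) : composeReflections P [] x = x := rfl

@[simp] lemma composeReflections_cons (s : ι × ℤ) (l : List (ι × ℤ)) (x : V) :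
    composeReflections P (s :: l) x = affineReflection P s (composeReflections P l x) := rfl

lemma composeReflections_append (l l' : List (ι × ℤ)) (x : V) :
    composeReflections P (l ++ l') x = composeReflections P l (composeReflections P l' x) := by
  simp [composeReflections]

variable [IsEuclidean P]

lemma reflection_eq_sub_inner (i : ι) (x : V) :
    P.reflection i x = x - ⟪x, P.root i⟫_ℝ • dualRoot P i := by
  have h : P.coroot' i x • P.root i = ⟪x, P.root i⟫_ℝ • dualRoot P i := by
    rw [toLinearMap_coroot, dualRoot, real_inner_smul_right, smul_smul, mul_comm]
  rw [P.reflection_apply, h]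

lemma inner_dualRoot_root_self (i : ι) : ⟪dualRoot P i, P.root i⟫_ℝ = 2 := by
  rw [real_inner_comm, ← pairing_eq_inner_dualRoot, P.pairing_same]

lemma reflection_dualRoot (i j : ι) :
    P.reflection i (dualRoot P j) = dualRoot P (P.reflectionPerm i j) := by
  simp only [dualRoot]
  rw [map_smul, P.root_reflectionPerm, IsEuclidean.inner_reflection]

lemma affineRoot_affineReflection_self (a : ι × ℤ) (x : V) :
    affineRoot P a (affineReflection P a x) = -affineRoot P a x := by
  conv_lhs => rw [affineRoot, affineReflection, inner_sub_left, real_inner_smul_left,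
    inner_dualRoot_root_self]
  rw [affineRoot]
  ring

lemma affineReflection_affineReflection (a : ι × ℤ) (x : V) :
    affineReflection P a (affineReflection P a x) = x := by
  rw [affineReflection, affineRoot_affineReflection_self]
  simp [affineReflection]

lemma affineReflection_eq_reflection_sub (a : ι × ℤ) (x : V) :
    affineReflection P a x = P.reflection a.1 x - (a.2 : ℝ) • dualRoot P a.1 := by
  rw [affineReflection, affineRoot, reflection_eq_sub_inner, add_smul, sub_sub]

variable [P.IsCrystallographic]

lemma affineRoot_reflectAffineRoot (s a : ι × ℤ) (x : V) :
    affineRoot P (reflectAffineRoot P s a) x = affineRoot P a (affineReflection P s x) := by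
  have h : (P.pairingIn ℤ a.1 s.1 : ℝ) = P.pairing a.1 s.1 := by
    rw [← P.algebraMap_pairingIn ℤ]; simp
  have h' : ⟪P.root a.1, dualRoot P s.1⟫_ℝ = P.pairing a.1 s.1 :=
    (pairing_eq_inner_dualRoot P _ _).symm
  have h'' : ⟪x, dualRoot P s.1⟫_ℝ * ⟪P.root a.1, P.root s.1⟫_ℝ =
      ⟪x, P.root s.1⟫_ℝ * P.pairing a.1 s.1 := by
    rw [← h', dualRoot, real_inner_smul_right, real_inner_smul_right]
    ring
  simp only [affineRoot, reflectAffineRoot, affineReflection]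
  rw [P.root_reflectionPerm, reflection_eq_sub_inner, inner_sub_right, inner_sub_left,
    real_inner_smul_left, real_inner_smul_right, real_inner_comm, real_inner_comm x,
    real_inner_comm (P.root a.1) (dualRoot P s.1), h']
  push_cast
  rw [h, real_inner_comm (P.root a.1) x]
  linear_combination -h''

/-- The reflection in a ∘ s is the conjugate s a s; multiplying by s on the left gives this
intertwining form. -/
lemma affineReflection_comp_reflectAffineRoot (s a : ι × ℤ) (x : V) :
    affineReflection P s (affineReflection P (reflectAffineRoot P s a) x) =
      affineReflection P a (affineReflection P s x) := by
  conv_rhs => rw [affineReflection, ← affineRoot_reflectAffineRoot]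
  conv_lhs => rw [affineReflection_eq_reflection_sub, affineReflection, map_sub, map_smul]
  rw [affineReflection_eq_reflection_sub]
  have : (reflectAffineRoot P s a).1 = P.reflectionPerm s.1 a.1 := rfl
  rw [this, reflection_dualRoot, P.reflectionPerm_self]
  abel

/-- The fold is the affine root c composed with the whole word, so this is the conjugation relation
for words; it is what allows letters to be cancelled. -/
lemma composeReflections_comp_foldl (l : List (ι × ℤ)) (c : ι × ℤ) (x : V) :
    composeReflections P l (affineReflection P (l.foldl (fun c s => reflectAffineRoot P s c) c) x) =
      affineReflection P c (composeReflections P l x) := by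
  induction l generalizing c with
  | nil => rfl
  | cons s l ih =>
    rw [List.foldl_cons, composeReflections_cons, ih, composeReflections_cons,
      affineReflection_comp_reflectAffineRoot]

lemma affineRoot_foldl (l : List (ι × ℤ)) (c : ι × ℤ) (x : V) :
    affineRoot P (l.foldl (fun c s => reflectAffineRoot P s c) c) x =
      affineRoot P c (composeReflections P l x) := by
  induction l generalizing c with
  | nil => rfl
  | cons s l ih => rw [List.foldl_cons, ih, composeReflections_cons, affineRoot_reflectAffineRoot]

end AffineRoots

/-! ### Positive affine roots and the deletion argument -/

section FundamentalDomain

variable {ι V N : Type*} [NormedAddCommGroup V] [InnerProductSpace ℝ V]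
  [AddCommGroup N] [Module ℝ N] {P : RootPairing ι ℝ V N} (b : P.Base) (t : ι)

/-- The simple affine roots with respect to the base `b`, where `t` is the lowest root. -/
def IsSimpleAffine (a : ι × ℤ) : Prop := (a.1 ∈ b.support ∧ a.2 = 0) ∨ a = (t, 1)

/-- The level of an affine root: the sum of its coefficients in the simple affine roots. -/
def level (a : ι × ℤ) : ℤ := b.height a.1 + (1 - b.height t) * a.2

lemma height_neg_root [P.IsRootSystem] {i j : ι} (h : P.root i = -P.root j) :
    b.height i = -b.height j := by
  obtain ⟨ρ, hρ⟩ := exists_inner_root_eq_height b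
  have := hρ i
  rw [h, inner_neg_left, hρ] at this
  exact_mod_cast this.symm

variable {t}

lemma sub_lowest_mem (ht : IsHighest (Set.range P.root) (simpleRoots b) (-P.root t)) (i : ι) :
    P.root i - P.root t ∈ AddSubmonoid.closure (simpleRoots b) := by
  have := ht.2 _ ⟨P.reflectionPerm i i, rfl⟩
  rwa [P.root_reflectionPerm, P.reflection_apply_self, neg_sub_neg] at this

lemma height_lowest_le [P.IsRootSystem]
    (ht : IsHighest (Set.range P.root) (simpleRoots b) (-P.root t)) (i : ι) :
    b.height t ≤ b.height i :=
  height_le_of_sub_mem_closure b (sub_lowest_mem b ht i)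

lemma height_le_neg_lowest [P.IsRootSystem]
    (ht : IsHighest (Set.range P.root) (simpleRoots b) (-P.root t)) (i : ι) :
    b.height i ≤ -b.height t := by
  have h := height_lowest_le b ht (P.reflectionPerm i i)
  have h1 : b.height (P.reflectionPerm i i) = -b.height i :=
    height_neg_root b (by rw [P.root_reflectionPerm, P.reflection_apply_self])
  omega

lemma height_lowest_neg [P.IsRootSystem]
    (ht : IsHighest (Set.range P.root) (simpleRoots b) (-P.root t)) : b.height t < 0 := by
  have h := height_le_neg_lowest b ht t
  have := b.height_ne_zero t
  omega

lemma level_of_isSimpleAffine {a : ι × ℤ} (ha : IsSimpleAffine b t a) : level b t a = 1 := by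
  rcases ha with ⟨h, h'⟩ | rfl
  · rw [level, RootPairing.Base.height_one_of_mem_support h, h']; ring
  · rw [level]; ring

/-- All heights lie between those of the lowest and the highest root, so one unit of the integer
part outweighs any height. The sign of the level is that of the integer part, and that of the height
when the integer part is 0. -/
lemma level_ne_zero [P.IsRootSystem]
    (ht : IsHighest (Set.range P.root) (simpleRoots b) (-P.root t)) (a : ι × ℤ) :
    level b t a ≠ 0 := by
  have h1 := height_lowest_le b ht a.1
  have h2 := height_le_neg_lowest b ht a.1
  have h3 := b.height_ne_zero a.1
  rw [level]
  rcases lt_trichotomy a.2 0 with h | h | h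
  · have : (1 - b.height t) * a.2 ≤ (1 - b.height t) * (-1) :=
      mul_le_mul_of_nonneg_left (by omega) (by omega)
    omega
  · rw [h]; omega
  · have : (1 - b.height t) * 1 ≤ (1 - b.height t) * a.2 :=
      mul_le_mul_of_nonneg_left (by omega) (by omega)
    omega

lemma level_pos_iff [P.IsRootSystem]
    (ht : IsHighest (Set.range P.root) (simpleRoots b) (-P.root t)) (a : ι × ℤ) :
    0 < level b t a ↔ 0 < a.2 ∨ (a.2 = 0 ∧ b.IsPos a.1) := by
  have h1 := height_lowest_le b ht a.1
  have h2 := height_le_neg_lowest b ht a.1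
  have h3 := height_lowest_neg b ht
  rw [level, RootPairing.Base.isPos_iff]
  rcases lt_trichotomy a.2 0 with h | h | h
  · have : (1 - b.height t) * a.2 ≤ (1 - b.height t) * (-1) :=
      mul_le_mul_of_nonneg_left (by omega) (by omega)
    omega
  · rw [h]; omega
  · have : (1 - b.height t) * 1 ≤ (1 - b.height t) * a.2 :=
      mul_le_mul_of_nonneg_left (by omega) (by omega)
    omega

/-- For a positive integer part, subtracting the lowest root leaves a sum of simple roots, and the
lowest root is at least -1 on the simplex. For integer part 0 the root is itself a sum of simple
roots. -/
lemma affineRoot_nonneg_of_level_pos [P.IsRootSystem]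
    (ht : IsHighest (Set.range P.root) (simpleRoots b) (-P.root t)) {a : ι × ℤ}
    (ha : 0 < level b t a) {x : V} (hx : x ∈ simplex (Set.range P.root) (simpleRoots b)) :
    0 ≤ affineRoot P a x := by
  have hs : ∀ y ∈ simpleRoots b, 0 ≤ ⟪y, x⟫_ℝ := fun y hy => by
    rw [real_inner_comm]; exact hx.1 y hy
  rw [affineRoot]
  rcases (level_pos_iff b ht a).mp ha with h | ⟨h, h'⟩
  · have h1 := inner_nonneg_of_mem_closure hs (sub_lowest_mem b ht a.1)
    have h2 := hx.2 _ ht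
    rw [inner_neg_right] at h2
    rw [inner_sub_left, real_inner_comm, real_inner_comm x] at h1
    have : (1 : ℝ) ≤ a.2 := by exact_mod_cast h
    linarith
  · have h1 := inner_nonneg_of_mem_closure hs ((isPos_iff_mem_closure b _).mp h')
    rw [real_inner_comm] at h1
    rw [h]; simpa using h1

/-- A point lies in the simplex iff the simple affine roots are nonnegative at it. -/
lemma mem_simplex_of_affineRoot_nonneg [P.IsRootSystem]
    (ht : IsHighest (Set.range P.root) (simpleRoots b) (-P.root t)) {x : V}
    (hx : ∀ a, IsSimpleAffine b t a → 0 ≤ affineRoot P a x) :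
    x ∈ simplex (Set.range P.root) (simpleRoots b) := by
  have hs : ∀ y ∈ simpleRoots b, 0 ≤ ⟪y, x⟫_ℝ := by
    rintro - ⟨i, hi, rfl⟩
    have := hx (i, 0) (Or.inl ⟨hi, rfl⟩)
    rw [real_inner_comm]
    simpa [affineRoot] using this
  refine ⟨fun y hy => by rw [real_inner_comm]; exact hs y hy, fun θ hθ => ?_⟩
  have h1 := inner_nonneg_of_mem_closure hs (ht.2 θ hθ.1)
  have h2 := hx (t, 1) (Or.inr rfl)
  rw [inner_sub_left, inner_neg_left, real_inner_comm, real_inner_comm x] at h1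
  simp only [affineRoot, Int.cast_one] at h2
  linarith

lemma level_reflectAffineRoot [P.IsRootSystem] [P.IsCrystallographic] (s a : ι × ℤ) :
    level b t (reflectAffineRoot P s a) =
      level b t a - P.pairingIn ℤ a.1 s.1 * level b t s := by
  have : P.root (P.reflectionPerm s.1 a.1) =
      P.root a.1 + (-P.pairingIn ℤ a.1 s.1) • P.root s.1 := by
    rw [P.root_reflectionPerm, neg_smul, P.reflection_apply_root' ℤ, sub_eq_add_neg]
  simp only [level, reflectAffineRoot]
  rw [b.height_add_zsmul this, smul_eq_mul]
  ring

lemma eq_zero_or_pos_of_mem_closure {S : Set V} {v x : V} (h : ∀ y ∈ S, 0 < ⟪y, v⟫_ℝ)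
    (hx : x ∈ AddSubmonoid.closure S) : x = 0 ∨ 0 < ⟪x, v⟫_ℝ := by
  induction hx using AddSubmonoid.closure_induction with
  | mem x hx => exact Or.inr (h x hx)
  | zero => simp
  | add x y _ _ hx hy =>
    rw [inner_add_left]
    rcases hx with rfl | hx
    · simpa using hy
    · rcases hy with rfl | hy
      · right; simpa using hx
      · exact Or.inr (add_pos hx hy)

/-- With a pairing of 2 or more, reflecting in t would exceed the maximal height unless i already
has the height of t; as i - t is a sum of simple roots, that means i = t. -/
lemma pairingIn_lowest_le_one [P.IsRootSystem] [P.IsCrystallographic]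
    (ht : IsHighest (Set.range P.root) (simpleRoots b) (-P.root t)) {i : ι} (hi : i ≠ t) :
    P.pairingIn ℤ i t ≤ 1 := by
  by_contra! h
  obtain ⟨ρ, hρ⟩ := exists_inner_root_eq_height b
  have hroot : P.root (P.reflectionPerm t i) =
      P.root i + (-P.pairingIn ℤ i t) • P.root t := by
    rw [P.root_reflectionPerm, neg_smul, P.reflection_apply_root' ℤ, sub_eq_add_neg]
  have h1 := b.height_add_zsmul hroot
  have h2 := height_le_neg_lowest b ht (P.reflectionPerm t i)
  have h3 := height_lowest_le b ht i
  have h4 := height_lowest_neg b ht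
  rw [smul_eq_mul] at h1
  have h5 : 2 * -b.height t ≤ P.pairingIn ℤ i t * -b.height t :=
    mul_le_mul_of_nonneg_right (by omega) (by omega)
  have h6 : b.height i = b.height t := by
    have : P.pairingIn ℤ i t * -b.height t = - P.pairingIn ℤ i t * b.height t := by ring
    omega
  rcases eq_zero_or_pos_of_mem_closure (v := ρ) (by
    rintro - ⟨k, hk, rfl⟩
    rw [hρ, RootPairing.Base.height_one_of_mem_support hk]; simp) (sub_lowest_mem b ht i)
    with h7 | h7
  · exact hi (P.root.injective (sub_eq_zero.mp h7))
  · rw [inner_sub_left, hρ, hρ, h6, sub_self] at h7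
    exact h7.false

variable [Finite ι] [P.IsRootSystem] [P.IsCrystallographic] [P.IsReduced]

/-- A simple affine reflection permutes the positive affine roots other than its own. -/
lemma level_reflectAffineRoot_pos
    (ht : IsHighest (Set.range P.root) (simpleRoots b) (-P.root t)) {s a : ι × ℤ}
    (hs : IsSimpleAffine b t s) (ha : 0 < level b t a) (has : a ≠ s) :
    0 < level b t (reflectAffineRoot P s a) := by
  rcases hs with ⟨h, h'⟩ | rfl
  · rw [level_pos_iff b ht] at ha ⊢
    simp only [reflectAffineRoot, h', zero_mul, sub_zero]
    refine ha.imp_right fun ⟨h0, hp⟩ => ⟨h0, ?_⟩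
    refine hp.reflectionPerm h fun heq => has ?_
    ext
    · exact heq
    · rw [h0, h']
  · have hne := level_ne_zero b ht (reflectAffineRoot P (t, 1) a)
    have hlev := level_reflectAffineRoot b (t := t) (t, 1) a
    rw [level_of_isSimpleAffine b (Or.inr rfl), mul_one] at hlev
    -- Over the lowest root the level drops by 2, but there the integer part is at least 2: with 0
    -- the affine root is negative, and with 1 it is s. Elsewhere the level drops by at most 1 and
    -- cannot reach 0.
    by_cases hat : a.1 = t
    · have h2 : P.pairingIn ℤ a.1 t = 2 := by rw [hat]; exact P.pairingIn_same ℤ t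
      have h3 := height_lowest_neg b ht
      have h4 : a.2 ≠ 1 := fun h => has (Prod.ext hat h)
      have h5 : 1 < a.2 := by
        rcases (level_pos_iff b ht a).mp ha with h | ⟨-, h⟩
        · omega
        · rw [RootPairing.Base.isPos_iff, hat] at h
          omega
      have h6 : (1 - b.height t) * 2 ≤ (1 - b.height t) * a.2 :=
        mul_le_mul_of_nonneg_left (by omega) (by omega)
      have h7 : level b t a = b.height t + (1 - b.height t) * a.2 := by rw [level, hat]
      dsimp only at hlev
      omega
    · have := pairingIn_lowest_le_one b ht hat
      dsimp only at hlev
      omega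

/-- A simple reflection makes only its own positive affine root negative. Hence the sign change must
occur at a letter equal to the root accumulated so far. -/
lemma exists_split_of_level_neg
    (ht : IsHighest (Set.range P.root) (simpleRoots b) (-P.root t)) (l : List (ι × ℤ))
    (hl : ∀ s ∈ l, IsSimpleAffine b t s) (c : ι × ℤ) (hc : 0 < level b t c)
    (h : level b t (l.foldl (fun c s => reflectAffineRoot P s c) c) < 0) :
    ∃ l₁ s l₂, l = l₁ ++ s :: l₂ ∧ l₁.foldl (fun c s => reflectAffineRoot P s c) c = s := by
  induction l generalizing c with
  | nil => exact absurd h hc.not_gt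
  | cons s l ih =>
    by_cases hcs : c = s
    · exact ⟨[], s, l, rfl, hcs⟩
    · obtain ⟨l₁, s', l₂, h1, h2⟩ := ih (fun s' hs' => hl s' (List.mem_cons_of_mem _ hs'))
        (reflectAffineRoot P s c)
        (level_reflectAffineRoot_pos b ht (hl s List.mem_cons_self) hc hcs) h
      exact ⟨s :: l₁, s', l₂, by rw [h1, List.cons_append], h2⟩

variable [IsEuclidean P]

/-- Induction on the length of the word s l. The affine root s is nonpositive at l x, because the
image s l x lies in the simplex. If s ∘ l is a negative affine root, two letters cancel; if it is
positive, s vanishes at l x and the first letter acts trivially. -/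
lemma composeReflections_eq_of_mem_simplex
    (ht : IsHighest (Set.range P.root) (simpleRoots b) (-P.root t)) (l : List (ι × ℤ))
    (hl : ∀ s ∈ l, IsSimpleAffine b t s) {x : V}
    (hx : x ∈ simplex (Set.range P.root) (simpleRoots b))
    (hlx : composeReflections P l x ∈ simplex (Set.range P.root) (simpleRoots b)) :
    composeReflections P l x = x := by
  induction hn : l.length using Nat.strong_induction_on generalizing l with
  | _ n ih =>
    cases l with
    | nil => rfl
    | cons s l =>
      have hs := hl s List.mem_cons_self
      have hl' : ∀ s ∈ l, IsSimpleAffine b t s := fun s' hs' => hl s' (List.mem_cons_of_mem _ hs')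
      have hs1 : 0 < level b t s := by rw [level_of_isSimpleAffine b hs]; exact one_pos
      have hy := affineRoot_nonneg_of_level_pos b ht hs1 hlx
      rw [composeReflections_cons, affineRoot_affineReflection_self] at hy
      rcases (level_ne_zero b ht
        (l.foldl (fun c s => reflectAffineRoot P s c) s)).lt_or_gt with hneg | hpos
      · obtain ⟨l₁, s', l₂, rfl, h2⟩ := exists_split_of_level_neg b ht l hl' s hs1 hneg
        -- As s ∘ l₁ is s', the word l₁ s' equals s l₁, so the leading s cancels.
        have h3 : composeReflections P (s :: (l₁ ++ s' :: l₂)) x =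
            composeReflections P (l₁ ++ l₂) x := by
          rw [composeReflections_cons, composeReflections_append, composeReflections_append,
            composeReflections_cons, ← h2, composeReflections_comp_foldl,
            affineReflection_affineReflection]
        rw [h3] at hlx ⊢
        refine ih (l₁ ++ l₂).length ?_ _ (fun u hu => hl' u ?_) hlx rfl
        · rw [← hn]; simp
        · rw [List.mem_append] at hu
          rw [List.mem_append, List.mem_cons]
          tauto
      · have h1 := affineRoot_nonneg_of_level_pos b ht hpos hx
        rw [affineRoot_foldl] at h1
        have h0 : affineRoot P s (composeReflections P l x) = 0 := by linarith
        have h3 : composeReflections P (s :: l) x = composeReflections P l x := by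
          rw [composeReflections_cons, affineReflection, h0, zero_smul, sub_zero]
        rw [h3] at hlx ⊢
        exact ih l.length (by rw [← hn]; simp) l hl' hlx rfl

end FundamentalDomain

/-! ### Generation by simple affine reflections; uniqueness in the simplex -/

section Words

variable {ι V N : Type*} [NormedAddCommGroup V] [InnerProductSpace ℝ V]
  [AddCommGroup N] [Module ℝ N] {P : RootPairing ι ℝ V N} (b : P.Base) {t : ι}
  [Finite ι] [P.IsRootSystem] [P.IsCrystallographic] [P.IsReduced] [IsEuclidean P]

/-- Otherwise pairing i with i - t, a sum of simple roots, gives ⟨i, i⟩ ≤ ⟨i, t⟩ ≤ 0. -/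
lemma exists_isSimpleAffine_pairingIn_pos
    (ht : IsHighest (Set.range P.root) (simpleRoots b) (-P.root t)) (i : ι) :
    ∃ s, IsSimpleAffine b t s ∧ 0 < P.pairingIn ℤ i s.1 := by
  by_contra! h
  have hle : ∀ s, IsSimpleAffine b t s → ⟪P.root i, P.root s.1⟫_ℝ ≤ 0 := fun s hs => by
    rw [← not_lt, ← pairingIn_pos_iff, not_lt]
    exact h s hs
  have h1 := inner_nonneg_of_mem_closure (v := -P.root i) (by
    rintro - ⟨j, hj, rfl⟩
    rw [inner_neg_right, real_inner_comm, neg_nonneg]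
    exact hle (j, 0) (Or.inl ⟨hj, rfl⟩)) (sub_lowest_mem b ht i)
  have h2 := hle (t, 1) (Or.inr rfl)
  have h3 := inner_root_self_pos P i
  rw [inner_neg_right, inner_sub_left, real_inner_comm (P.root i) (P.root t)] at h1
  dsimp only at h2
  linarith

/-- Induction on the level: conjugating by a simple affine reflection with positive pairing lowers
the level and keeps it positive. -/
lemma exists_composeReflections_of_level_pos
    (ht : IsHighest (Set.range P.root) (simpleRoots b) (-P.root t)) (a : ι × ℤ)
    (ha : 0 < level b t a) :
    ∃ l : List (ι × ℤ), (∀ s ∈ l, IsSimpleAffine b t s) ∧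
      ∀ x, composeReflections P l x = affineReflection P a x := by
  induction hn : (level b t a).toNat using Nat.strong_induction_on generalizing a with
  | _ n ih =>
    by_cases has : IsSimpleAffine b t a
    · exact ⟨[a], by simpa using has, fun x => rfl⟩
    obtain ⟨s, hs, hpos⟩ := exists_isSimpleAffine_pairingIn_pos b ht a.1
    have hne : a ≠ s := fun h => has (h ▸ hs)
    have h1 := level_reflectAffineRoot_pos b ht hs ha hne
    have h2 := level_reflectAffineRoot b (t := t) s a
    rw [level_of_isSimpleAffine b hs, mul_one] at h2
    obtain ⟨l, hl, hla⟩ := ih (level b t (reflectAffineRoot P s a)).toNat (by omega) _ h1 rfl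
    refine ⟨s :: (l ++ [s]), ?_, fun x => ?_⟩
    · intro u hu
      simp only [List.mem_cons, List.mem_append, List.not_mem_nil, or_false] at hu
      rcases hu with rfl | hu | rfl
      exacts [hs, hl u hu, hs]
    · rw [composeReflections_cons, composeReflections_append, hla,
        affineReflection_comp_reflectAffineRoot, composeReflections_cons, composeReflections_nil,
        affineReflection_affineReflection]

omit [Finite ι] [P.IsRootSystem] [P.IsCrystallographic] [P.IsReduced] in
lemma affineReflection_neg (a : ι × ℤ) (x : V) :
    affineReflection P (P.reflectionPerm a.1 a.1, -a.2) x = affineReflection P a x := by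
  have h : P.root (P.reflectionPerm a.1 a.1) = -P.root a.1 := by
    rw [P.root_reflectionPerm, P.reflection_apply_self]
  simp only [affineReflection, affineRoot, dualRoot, h]
  simp only [inner_neg_right, inner_neg_left, neg_neg, smul_neg, Int.cast_neg]
  rw [← neg_smul]
  congr 2
  ring

lemma exists_composeReflections_affineReflection
    (ht : IsHighest (Set.range P.root) (simpleRoots b) (-P.root t)) (a : ι × ℤ) :
    ∃ l : List (ι × ℤ), (∀ s ∈ l, IsSimpleAffine b t s) ∧
      ∀ x, composeReflections P l x = affineReflection P a x := by
  rcases (level_ne_zero b ht a).lt_or_gt with h | h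
  · obtain ⟨l, hl, hla⟩ := exists_composeReflections_of_level_pos b ht
      (P.reflectionPerm a.1 a.1, -a.2) (by
        have h1 : b.height (P.reflectionPerm a.1 a.1) = -b.height a.1 :=
          height_neg_root b (by rw [P.root_reflectionPerm, P.reflection_apply_self])
        rw [level] at h ⊢
        rw [h1, mul_neg]
        omega)
    exact ⟨l, hl, fun x => by rw [hla, affineReflection_neg]⟩
  · exact exists_composeReflections_of_level_pos b ht a h

/-- The product of the reflections in two parallel hyperplanes of a root is a translation by a
multiple of its dual root. -/
lemma exists_composeReflections_translation
    (ht : IsHighest (Set.range P.root) (simpleRoots b) (-P.root t)) {q : V}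
    (hq : q ∈ dualRootLattice b) :
    ∃ l : List (ι × ℤ), (∀ s ∈ l, IsSimpleAffine b t s) ∧
      ∀ x, composeReflections P l x = x + q := by
  have key : ∀ (i : ι) (k : ℤ), ∃ l : List (ι × ℤ), (∀ s ∈ l, IsSimpleAffine b t s) ∧
      ∀ x, composeReflections P l x = x + (k : ℝ) • dualRoot P i := by
    intro i k
    obtain ⟨l, hl, h⟩ := exists_composeReflections_affineReflection b ht (i, 0)
    obtain ⟨l', hl', h'⟩ := exists_composeReflections_affineReflection b ht (i, k)
    refine ⟨l ++ l', fun s hs => (List.mem_append.mp hs).elim (hl s) (hl' s), fun x => ?_⟩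
    rw [composeReflections_append, h, h', affineReflection_eq_reflection_sub,
      affineReflection_eq_reflection_sub, map_sub, map_smul, P.reflection_same,
      reflection_eq_sub_inner P i (dualRoot P i), inner_dualRoot_root_self, two_smul]
    simp
  -- The statement carries both q and -q so that the negation step of the closure induction is a
  -- swap.
  have main : ∀ q ∈ dualRootLattice b,
      (∃ l : List (ι × ℤ), (∀ s ∈ l, IsSimpleAffine b t s) ∧
        ∀ x, composeReflections P l x = x + q) ∧
      (∃ l : List (ι × ℤ), (∀ s ∈ l, IsSimpleAffine b t s) ∧
        ∀ x, composeReflections P l x = x + -q) := by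
    intro q hq
    induction hq using AddSubgroup.closure_induction with
    | mem q hq =>
      obtain ⟨i, -, rfl⟩ := hq
      refine ⟨?_, ?_⟩
      · simpa using key i 1
      · simpa using key i (-1)
    | zero => exact ⟨⟨[], by simp⟩, ⟨[], by simp⟩⟩
    | neg q _ h => exact ⟨h.2, by simpa using h.1⟩
    | add q q' _ _ h h' =>
      obtain ⟨⟨l₁, hl₁, h₁⟩, ⟨l₂, hl₂, h₂⟩⟩ := h
      obtain ⟨⟨l₁', hl₁', h₁'⟩, ⟨l₂', hl₂', h₂'⟩⟩ := h'
      refine ⟨⟨l₁ ++ l₁', fun s hs => (List.mem_append.mp hs).elim (hl₁ s) (hl₁' s),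
        fun x => ?_⟩, ⟨l₂ ++ l₂', fun s hs => (List.mem_append.mp hs).elim (hl₂ s) (hl₂' s),
        fun x => ?_⟩⟩
      · rw [composeReflections_append, h₁', h₁]; abel
      · rw [composeReflections_append, h₂', h₂]; abel
  exact (main q hq).1

lemma exists_composeReflections_linear
    (ht : IsHighest (Set.range P.root) (simpleRoots b) (-P.root t)) {w : V ≃ₗ[ℝ] V}
    (hw : w ∈ weylGroup b) :
    ∃ l : List (ι × ℤ), (∀ s ∈ l, IsSimpleAffine b t s) ∧
      ∀ x, composeReflections P l x = w x := by
  have key : ∀ i, ∃ l : List (ι × ℤ), (∀ s ∈ l, IsSimpleAffine b t s) ∧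
      ∀ x, composeReflections P l x = P.reflection i x := fun i => by
    obtain ⟨l, hl, h⟩ := exists_composeReflections_affineReflection b ht (i, 0)
    exact ⟨l, hl, fun x => by rw [h, affineReflection_eq_reflection_sub]; simp⟩
  induction hw using Subgroup.closure_induction'' with
  | mem w hw =>
    obtain ⟨i, -, rfl⟩ := hw
    exact key i
  | inv_mem w hw =>
    obtain ⟨i, -, rfl⟩ := hw
    rw [P.reflection_inv]
    exact key i
  | one => exact ⟨[], by simp⟩
  | mul w w' _ _ h h' =>
    obtain ⟨l, hl, h⟩ := h
    obtain ⟨l', hl', h'⟩ := h'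
    refine ⟨l ++ l', fun s hs => (List.mem_append.mp hs).elim (hl s) (hl' s), fun x => ?_⟩
    rw [composeReflections_append, h', h]
    rfl

/-- Two points of the closed fundamental simplex in the same orbit of the affine Weyl group are
equal. -/
theorem eq_of_mem_simplex [P.IsIrreducible] {x q : V} {w : V ≃ₗ[ℝ] V} (hw : w ∈ weylGroup b)
    (hq : q ∈ dualRootLattice b) (hx : x ∈ simplex (Set.range P.root) (simpleRoots b))
    (hy : w x + q ∈ simplex (Set.range P.root) (simpleRoots b)) : w x + q = x := by
  obtain ⟨i, hi⟩ := exists_isHighest b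
  have ht : IsHighest (Set.range P.root) (simpleRoots b) (-P.root (P.reflectionPerm i i)) := by
    rwa [P.root_reflectionPerm, P.reflection_apply_self, neg_neg]
  obtain ⟨l, hl, h⟩ := exists_composeReflections_linear b ht hw
  obtain ⟨l', hl', h'⟩ := exists_composeReflections_translation b ht hq
  have hc : composeReflections P (l' ++ l) x = w x + q := by
    rw [composeReflections_append, h', h]
  rw [← hc] at hy ⊢
  exact composeReflections_eq_of_mem_simplex b ht _
    (fun s hs => (List.mem_append.mp hs).elim (hl' s) (hl s)) hx hy

end Words

/-! ### Every affine orbit meets the simplex -/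

section Existence

variable {ι V N : Type*} [NormedAddCommGroup V] [InnerProductSpace ℝ V]
  [AddCommGroup N] [Module ℝ N] {P : RootPairing ι ℝ V N} (b : P.Base)

/-- The basis of simple dual roots. -/
def simpleDualBasis [P.IsRootSystem] : Module.Basis b.support ℝ V :=
  b.toWeightBasis.isUnitSMul (w := fun i => 2 / ⟪P.root i, P.root i⟫_ℝ)
    fun i => (div_ne_zero two_ne_zero (inner_root_self_pos P i).ne').isUnit

lemma simpleDualBasis_apply [P.IsRootSystem] (i : b.support) :
    simpleDualBasis b i = dualRoot P i := by
  rw [simpleDualBasis, Module.Basis.isUnitSMul_apply, b.toWeightBasis_apply, dualRoot]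

lemma range_simpleDualBasis [P.IsRootSystem] :
    Set.range (simpleDualBasis b) = simpleDualRoots b := by
  ext x
  simp [simpleDualBasis_apply, simpleDualRoots]

lemma coe_span_simpleDualBasis [P.IsRootSystem] :
    (Submodule.span ℤ (Set.range (simpleDualBasis b)) : Set V) = dualRootLattice b := by
  rw [range_simpleDualBasis, dualRootLattice, ← Submodule.span_int_eq_addSubgroupClosure]
  rfl

lemma finite_inter_dualRootLattice [P.IsRootSystem] {s : Set V} (hs : Bornology.IsBounded s) :
    (s ∩ dualRootLattice b).Finite := by
  have := finiteDimensional_of_base b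
  have : ProperSpace V := FiniteDimensional.proper ℝ V
  rw [← coe_span_simpleDualBasis]
  exact ZSpan.setFinite_inter _ hs

variable [Finite ι] [P.IsRootSystem] [P.IsCrystallographic] [IsEuclidean P]

/-- Every root is reached from simple roots by simple reflections; these conjugate reflections and
move dual roots within the stable lattice. -/
lemma reflection_mem_weylGroup [P.IsReduced] (i : ι) :
    P.reflection i ∈ weylGroup b ∧ dualRoot P i ∈ dualRootLattice b := by
  refine b.induction_reflect i (p := fun i => P.reflection i ∈ weylGroup b ∧
    dualRoot P i ∈ dualRootLattice b) ?_ ?_ ?_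
  · rintro i ⟨h, h'⟩
    rw [P.reflection_reflectionPerm, ← reflection_dualRoot]
    exact ⟨mul_mem (mul_mem h h) h, dualRootLattice_stable b _ h _ h'⟩
  · exact fun i hi => ⟨Subgroup.subset_closure ⟨i, hi, rfl⟩,
      AddSubgroup.subset_closure ⟨i, hi, rfl⟩⟩
  · rintro i j ⟨h, h'⟩ hj
    have hjw : P.reflection j ∈ weylGroup b := Subgroup.subset_closure ⟨j, hj, rfl⟩
    rw [P.reflection_reflectionPerm, ← reflection_dualRoot]
    exact ⟨mul_mem (mul_mem hjw h) hjw, dualRootLattice_stable b _ hjw _ h'⟩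

-- Reflecting y to the side of the hyperplane on which p lies brings it nearer to p; the squared
-- distance drops by a positive multiple of the product of the two distances to the hyperplane.
omit [Finite ι] [P.IsRootSystem] [P.IsCrystallographic] [IsEuclidean P] in
lemma dist_affineReflection_lt {a : ι × ℤ} {p y : V} (hp : 0 < affineRoot P a p)
    (hy : affineRoot P a y < 0) : dist (affineReflection P a y) p < dist y p := by
  have hr := inner_root_self_pos P a.1
  rw [dist_eq_norm, dist_eq_norm]
  refine lt_of_pow_lt_pow_left₀ 2 (norm_nonneg _) ?_
  have h1 : affineReflection P a y - p = (y - p) - affineRoot P a y • dualRoot P a.1 := by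
    rw [affineReflection]; abel
  have h2 : ⟪y - p, dualRoot P a.1⟫_ℝ =
      2 / ⟪P.root a.1, P.root a.1⟫_ℝ * (affineRoot P a y - affineRoot P a p) := by
    rw [dualRoot, real_inner_smul_right, inner_sub_left, affineRoot, affineRoot]
    ring
  have h3 : ‖dualRoot P a.1‖ ^ 2 = 4 / ⟪P.root a.1, P.root a.1⟫_ℝ := by
    rw [← real_inner_self_eq_norm_sq, dualRoot, real_inner_smul_left, real_inner_smul_right]
    field_simp
    norm_num
  rw [h1, norm_sub_sq_real, real_inner_smul_right, norm_smul, mul_pow, h2, h3, Real.norm_eq_abs,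
    sq_abs]
  have h4 : 0 < 4 / ⟪P.root a.1, P.root a.1⟫_ℝ * (affineRoot P a p * -affineRoot P a y) :=
    mul_pos (by positivity) (mul_pos hp (neg_pos.mpr hy))
  have h5 : 4 / ⟪P.root a.1, P.root a.1⟫_ℝ = 2 * (2 / ⟪P.root a.1, P.root a.1⟫_ℝ) := by ring
  rw [h5] at h4 ⊢
  linarith

/-- Every orbit of the affine Weyl group meets the closed fundamental simplex. -/
theorem exists_mem_simplex [P.IsReduced] [P.IsIrreducible] (x : V) :
    ∃ w ∈ weylGroup b, ∃ q ∈ dualRootLattice b,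
      w x + q ∈ simplex (Set.range P.root) (simpleRoots b) := by
  obtain ⟨i, hi⟩ := exists_isHighest b
  obtain ⟨t, ht⟩ : ∃ t, IsHighest (Set.range P.root) (simpleRoots b) (-P.root t) :=
    ⟨P.reflectionPerm i i, by rwa [P.root_reflectionPerm, P.reflection_apply_self, neg_neg]⟩
  obtain ⟨ρ, hρ⟩ := exists_inner_root_eq_height b
  have hN : (0 : ℝ) < 1 - b.height t := by
    have := height_lowest_neg b ht
    have : (b.height t : ℝ) < 0 := by exact_mod_cast this
    linarith
  -- At this point every simple affine root equals its level 1 divided by 1 - ht t, so p is interior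
  -- to the simplex.
  set p : V := (1 - b.height t : ℝ)⁻¹ • ρ with hpdef
  have hp : ∀ a, IsSimpleAffine b t a → 0 < affineRoot P a p := by
    intro a ha
    have h1 := level_of_isSimpleAffine b ha
    have h2 : affineRoot P a p = (1 - b.height t : ℝ)⁻¹ * (level b t a : ℤ) := by
      rw [affineRoot, hpdef, real_inner_smul_left, real_inner_comm, hρ, level]
      push_cast
      field_simp
    rw [h2, h1]
    simpa using hN
  let orbit : Set V := {y | ∃ w ∈ weylGroup b, ∃ q ∈ dualRootLattice b, y = w x + q}
  -- For each of the finitely many linear parts, the translations that land in the ball lie in a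
  -- bounded part of a discrete lattice.
  have hfin : (orbit ∩ Metric.closedBall p (dist x p)).Finite := by
    refine (Set.finite_iUnion fun w : weylGroup b =>
      ((finite_inter_dualRootLattice b
        (Metric.isBounded_closedBall (x := p - w.1 x) (r := dist x p))).image
          fun q => w.1 x + q)).subset ?_
    rintro y ⟨⟨w, hw, q, hq, rfl⟩, hy⟩
    refine Set.mem_iUnion.mpr ⟨⟨w, hw⟩, q, ⟨?_, hq⟩, rfl⟩
    rw [Metric.mem_closedBall, dist_eq_norm] at hy ⊢
    rwa [show q - (p - w x) = w x + q - p by abel]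
  have hxo : x ∈ orbit := ⟨1, one_mem _, 0, zero_mem _, by simp⟩
  obtain ⟨y, ⟨⟨w, hw, q, hq, rfl⟩, hyp⟩, hmin⟩ := Set.exists_min_image _ (fun y => dist y p) hfin
    ⟨x, hxo, Metric.mem_closedBall.mpr le_rfl⟩
  refine ⟨w, hw, q, hq, mem_simplex_of_affineRoot_nonneg b ht fun a ha => ?_⟩
  by_contra! hneg
  have hlt := dist_affineReflection_lt (hp a ha) hneg
  refine hlt.not_ge (hmin _ ⟨?_, Metric.mem_closedBall.mpr
    (hlt.le.trans (Metric.mem_closedBall.mp hyp))⟩)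
  obtain ⟨hr, hd⟩ := reflection_mem_weylGroup b a.1
  refine ⟨P.reflection a.1 * w, mul_mem hr hw,
    P.reflection a.1 q - (a.2 : ℝ) • dualRoot P a.1,
    sub_mem (dualRootLattice_stable b _ hr _ hq) ?_, ?_⟩
  · rw [Int.cast_smul_eq_zsmul ℝ]
    exact zsmul_mem hd _
  · rw [affineReflection_eq_reflection_sub, map_add, LinearEquiv.mul_apply, add_sub_assoc]

end Existence

/-! ### The dual root system in the same Euclidean space -/

section Dual

variable {ι V N : Type*} [NormedAddCommGroup V] [InnerProductSpace ℝ V]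
  [AddCommGroup N] [Module ℝ N]

lemma isPerfPair_innerₗ [FiniteDimensional ℝ V] : (innerₗ V).IsPerfPair := by
  have h : Function.Injective (innerₗ V) := by
    rw [← LinearMap.ker_eq_bot, LinearMap.ker_eq_bot']
    intro x hx
    exact inner_self_eq_zero.mp (LinearMap.congr_fun hx x)
  refine LinearMap.IsPerfPair.of_injective h ?_
  rwa [flip_innerₗ]

lemma smul_dualRoot (P : RootPairing ι ℝ V N) (i : ι) :
    (2 / ⟪dualRoot P i, dualRoot P i⟫_ℝ) • dualRoot P i = P.root i := by
  have := (inner_root_self_pos P i).ne'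
  rw [dualRoot, real_inner_smul_left, real_inner_smul_right, smul_smul]
  conv_rhs => rw [← one_smul ℝ (P.root i)]
  congr 1
  field_simp

variable [FiniteDimensional ℝ V]

/-- The dual root system, realised in the same Euclidean space. -/
def dualRootPairing (P : RootPairing ι ℝ V N) [IsEuclidean P] : RootPairing ι ℝ V V where
  toLinearMap := innerₗ V
  isPerfPair_toLinearMap := isPerfPair_innerₗ
  root := ⟨dualRoot P, fun i j h => P.root.injective (by
    rw [← smul_dualRoot P i, ← smul_dualRoot P j, h])⟩
  coroot := P.root
  root_coroot_two i := inner_dualRoot_root_self P i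
  reflectionPerm := P.reflectionPerm
  reflectionPerm_root i j := by
    change dualRoot P j - ⟪dualRoot P j, P.root i⟫_ℝ • dualRoot P i = dualRoot P (P.reflectionPerm i j)
    rw [← reflection_dualRoot, reflection_eq_sub_inner]
  reflectionPerm_coroot i j := by
    change P.root j - ⟪dualRoot P i, P.root j⟫_ℝ • P.root i = P.root (P.reflectionPerm i j)
    rw [P.root_reflectionPerm, P.reflection_apply, toLinearMap_coroot, real_inner_comm]

variable (P : RootPairing ι ℝ V N) [IsEuclidean P]

lemma dualRoot_dualRootPairing : dualRoot (dualRootPairing P) = P.root :=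
  funext (smul_dualRoot P)

lemma dualRootPairing_reflection (i : ι) :
    (dualRootPairing P).reflection i = P.reflection i := by
  ext x
  rw [reflection_eq_sub_inner P i x, RootPairing.reflection_apply]
  rfl

instance : IsEuclidean (dualRootPairing P) where
  inner_reflection i x y := by
    rw [dualRootPairing_reflection]
    exact IsEuclidean.inner_reflection i x y

instance [P.IsCrystallographic] : (dualRootPairing P).IsCrystallographic where
  exists_value i j := by
    obtain ⟨k, hk⟩ := P.exists_value (S := ℤ) j i
    refine ⟨k, hk.trans ?_⟩
    rw [pairing_eq_inner_dualRoot, real_inner_comm]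
    rfl

instance [Finite ι] [P.IsReduced] : (dualRootPairing P).IsReduced :=
  have : (dualRootPairing P).flip.IsReduced := ⟨fun i j h => RootPairing.IsReduced.eq_or_eq_neg
    (P := P) i j h⟩
  RootPairing.instFlipIsReduced (dualRootPairing P).flip

instance [P.IsIrreducible] : (dualRootPairing P).IsIrreducible where
  nontrivial := RootPairing.IsIrreducible.nontrivial P
  nontrivial' := RootPairing.IsIrreducible.nontrivial P
  eq_top_of_invtSubmodule_reflection q hq :=
    RootPairing.IsIrreducible.eq_top_of_invtSubmodule_reflection (P := P) q fun i => by
      rw [← dualRootPairing_reflection]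
      exact hq i
  eq_top_of_invtSubmodule_coreflection q hq :=
    RootPairing.IsIrreducible.eq_top_of_invtSubmodule_reflection (P := P) q fun i => by
      have h : P.reflection i = (dualRootPairing P).coreflection i := by
        ext x
        rw [P.reflection_apply, toLinearMap_coroot, real_inner_comm,
          RootPairing.coreflection_apply]
        rfl
      rw [h]
      exact hq i

variable {P}

lemma linearIndepOn_dualRoot (b : P.Base) [P.IsRootSystem] :
    LinearIndepOn ℝ (dualRoot P) b.support := by
  have h := (simpleDualBasis b).linearIndependent
  have h' : (simpleDualBasis b : b.support → V) = fun i : b.support => dualRoot P i :=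
    funext (simpleDualBasis_apply b)
  rw [h'] at h
  exact h

instance [P.IsRootSystem] : (dualRootPairing P).IsRootSystem where
  span_root_eq_top := by
    refine top_le_iff.mp ?_
    rw [← RootPairing.IsRootSystem.span_root_eq_top (P := P), Submodule.span_le]
    rintro - ⟨i, rfl⟩
    rw [← smul_dualRoot P i]
    exact Submodule.smul_mem _ _ (Submodule.subset_span ⟨i, rfl⟩)
  span_coroot_eq_top := RootPairing.IsRootSystem.span_root_eq_top (P := P)

/-- The base of the dual root system formed by the simple dual roots. -/
def dualBase [Finite ι] [P.IsRootSystem] [P.IsCrystallographic] [P.IsReduced] (b : P.Base) :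
    (dualRootPairing P).Base where
  support := b.support
  linearIndepOn_root := linearIndepOn_dualRoot b
  linearIndepOn_coroot := b.linearIndepOn_root
  root_mem_or_neg_mem :=
    -- In the flipped dual pairing the original roots serve as roots and the dual roots as coroots,
    -- so positivity passes from the former to the latter.
    RootPairing.coroot_mem_or_neg_mem_closure_of_root (dualRootPairing P).flip b.support
      b.linearIndepOn_root b.root_mem_or_neg_mem
  coroot_mem_or_neg_mem := b.root_mem_or_neg_mem

variable [Finite ι] [P.IsRootSystem] [P.IsCrystallographic] [P.IsReduced] (b : P.Base)

lemma weylGroup_dualBase : weylGroup (dualBase b) = weylGroup b := by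
  rw [weylGroup, weylGroup]
  congr 1
  exact Set.image_congr fun i _ => dualRootPairing_reflection P i

lemma dualRootLattice_dualBase : dualRootLattice (dualBase b) = rootLattice b := by
  rw [dualRootLattice, simpleDualRoots, dualRoot_dualRootPairing]
  rfl

variable [P.IsIrreducible]

/-- Two points of the dual closed fundamental simplex in the same orbit of the dual affine Weyl
group are equal. -/
theorem eq_of_mem_dual_simplex {x q : V} {w : V ≃ₗ[ℝ] V} (hw : w ∈ weylGroup b)
    (hq : q ∈ rootLattice b) (hx : x ∈ simplex (Set.range (dualRoot P)) (simpleDualRoots b))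
    (hy : w x + q ∈ simplex (Set.range (dualRoot P)) (simpleDualRoots b)) : w x + q = x := by
  rw [← weylGroup_dualBase] at hw
  rw [← dualRootLattice_dualBase] at hq
  -- The simplex of `dualBase b` is the dual simplex by definition: the roots of `dualRootPairing P`
  -- are the dual roots, and the support is unchanged.
  exact eq_of_mem_simplex (dualBase b) hw hq hx hy

/-- Every orbit of the dual affine Weyl group meets the dual closed fundamental simplex. -/
theorem exists_mem_dual_simplex (x : V) : ∃ w ∈ weylGroup b, ∃ q ∈ rootLattice b,
    w x + q ∈ simplex (Set.range (dualRoot P)) (simpleDualRoots b) := by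
  rw [← weylGroup_dualBase, ← dualRootLattice_dualBase]
  exact exists_mem_simplex (dualBase b) x

end Dual

/-! ### The index of Q^∨ in (1/M) P^∨ -/

section Index

variable {ι V N : Type*} [NormedAddCommGroup V] [InnerProductSpace ℝ V]
  [AddCommGroup N] [Module ℝ N] {P : RootPairing ι ℝ V N} (b : P.Base)

lemma inner_mem_int_of_mem_closure {T : Set V} {x y : V} (h : ∀ y ∈ T, ∃ k : ℤ, ⟪x, y⟫_ℝ = k)
    (hy : y ∈ AddSubgroup.closure T) : ∃ k : ℤ, ⟪x, y⟫_ℝ = k := by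
  induction hy using AddSubgroup.closure_induction with
  | mem y hy => exact h y hy
  | zero => exact ⟨0, by simp⟩
  | add y z _ _ h h' =>
    obtain ⟨k, hk⟩ := h
    obtain ⟨l, hl⟩ := h'
    exact ⟨k + l, by rw [inner_add_right, hk, hl]; push_cast; rfl⟩
  | neg y _ h =>
    obtain ⟨k, hk⟩ := h
    exact ⟨-k, by rw [inner_neg_right, hk]; push_cast; rfl⟩

/-- The refined dual weight lattice `(1/M) P^∨`. -/
def refinedLattice (M : ℕ) : AddSubgroup V where
  carrier := {x | ∀ y ∈ rootLattice b, ∃ k : ℤ, ⟪(M : ℝ) • x, y⟫_ℝ = k}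
  zero_mem' := fun y _ => ⟨0, by simp⟩
  add_mem' := by
    intro x x' hx hx' y hy
    obtain ⟨k, hk⟩ := hx y hy
    obtain ⟨l, hl⟩ := hx' y hy
    exact ⟨k + l, by rw [smul_add, inner_add_left, hk, hl]; push_cast; rfl⟩
  neg_mem' := by
    intro x hx y hy
    obtain ⟨k, hk⟩ := hx y hy
    exact ⟨-k, by rw [smul_neg, inner_neg_left, hk]; push_cast; rfl⟩

lemma coe_refinedLattice {M : ℕ} (hM : 0 < M) :
    (refinedLattice b M : Set V) = (M : ℝ)⁻¹ • dualWeightLattice b := by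
  ext x
  rw [Set.mem_inv_smul_set_iff₀ (by exact_mod_cast hM.ne')]
  rfl

lemma mem_refinedLattice_iff {M : ℕ} {x : V} :
    x ∈ refinedLattice b M ↔ ∀ i ∈ b.support, ∃ k : ℤ, (M : ℝ) * ⟪x, P.root i⟫_ℝ = k := by
  constructor
  · intro h i hi
    obtain ⟨k, hk⟩ := h (P.root i) (AddSubgroup.subset_closure ⟨i, hi, rfl⟩)
    exact ⟨k, by rw [← hk, real_inner_smul_left]⟩
  · intro h y hy
    refine inner_mem_int_of_mem_closure (T := simpleRoots b) ?_ hy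
    rintro - ⟨i, hi, rfl⟩
    obtain ⟨k, hk⟩ := h i hi
    exact ⟨k, by rw [← hk, real_inner_smul_left]⟩

lemma ext_inner_simple [P.IsRootSystem] {x y : V}
    (h : ∀ i ∈ b.support, ⟪x, P.root i⟫_ℝ = ⟪y, P.root i⟫_ℝ) : x = y := by
  refine ext_inner_right ℝ fun v => ?_
  rw [← b.toWeightBasis.sum_repr v, inner_sum, inner_sum]
  refine Finset.sum_congr rfl fun i _ => ?_
  rw [real_inner_smul_right, real_inner_smul_right, b.toWeightBasis_apply, h i i.2]

/-- The coordinates with respect to the fundamental dual weights divided by `M`. -/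
def refinedCoords [P.IsRootSystem] {M : ℕ} (hM : 0 < M) : V ≃ₗ[ℝ] (b.support → ℝ) :=
  LinearEquiv.ofBijective
    (LinearMap.pi fun i : b.support => (M : ℝ) • innerₗ V (P.root i)) (by
      have hM' : (M : ℝ) ≠ 0 := by exact_mod_cast hM.ne'
      constructor
      · intro x y h
        refine ext_inner_simple b fun i hi => ?_
        have := congrFun h ⟨i, hi⟩
        simp only [LinearMap.pi_apply, LinearMap.smul_apply, innerₗ_apply_apply, smul_eq_mul] at this
        rw [real_inner_comm, mul_left_cancel₀ hM' this, real_inner_comm]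
      · intro f
        obtain ⟨v, hv⟩ := exists_inner_simple_eq b fun i => (M : ℝ)⁻¹ * f i
        refine ⟨v, funext fun i => ?_⟩
        simp only [LinearMap.pi_apply, LinearMap.smul_apply, innerₗ_apply_apply, smul_eq_mul]
        rw [hv, mul_inv_cancel_left₀ hM'])

/-- The basis of fundamental dual weights divided by `M`. -/
def refinedBasis [P.IsRootSystem] {M : ℕ} (hM : 0 < M) : Module.Basis b.support ℝ V :=
  Module.Basis.ofEquivFun (refinedCoords b hM)

lemma refinedBasis_repr [P.IsRootSystem] {M : ℕ} (hM : 0 < M) (x : V) (i : b.support) :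
    (refinedBasis b hM).repr x i = (M : ℝ) * ⟪x, P.root i⟫_ℝ := by
  rw [refinedBasis, Module.Basis.ofEquivFun_repr_apply, real_inner_comm]
  rfl

lemma refinedLattice_eq_closure [P.IsRootSystem] {M : ℕ} (hM : 0 < M) :
    refinedLattice b M = AddSubgroup.closure (Set.range (refinedBasis b hM)) := by
  ext x
  rw [mem_refinedLattice_iff, ← Submodule.span_int_eq_addSubgroupClosure,
    Submodule.mem_toAddSubgroup, Module.Basis.mem_span_iff_repr_mem]
  simp only [refinedBasis_repr, Subtype.forall]
  refine forall₂_congr fun i hi => ?_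
  simp [eq_comm]

variable [P.IsCrystallographic] [IsEuclidean P]

lemma inner_dualRoot_root_eq (i j : ι) :
    ⟪dualRoot P i, P.root j⟫_ℝ = (P.pairingIn ℤ j i : ℝ) := by
  rw [real_inner_comm, ← pairing_eq_inner_dualRoot, ← P.algebraMap_pairingIn ℤ]
  simp

lemma dualRootLattice_le_refinedLattice (M : ℕ) :
    dualRootLattice b ≤ refinedLattice b M := by
  intro x hx
  rw [mem_refinedLattice_iff]
  intro i hi
  obtain ⟨k, hk⟩ := inner_mem_int_of_mem_closure (x := P.root i) (T := simpleDualRoots b) (by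
    rintro - ⟨j, -, rfl⟩
    exact ⟨_, by rw [real_inner_comm, inner_dualRoot_root_eq]⟩) hx
  exact ⟨M * k, by rw [real_inner_comm, hk]; push_cast; rfl⟩

variable [P.IsRootSystem]

/-- The Cartan matrix is the positive definite Gram matrix of the simple roots times a positive
diagonal matrix. Positivity removes the absolute value in the index formula and makes the quotient
finite. -/
lemma connectionIndex_pos : 0 < connectionIndex b := by
  classical
  have hG : (Matrix.gram ℝ fun i : b.support => P.root i).PosDef :=
    Matrix.posDef_gram_of_linearIndependent b.linearIndepOn_root
  have h1 : (b.cartanMatrix.map (Int.cast : ℤ → ℝ)) =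
      Matrix.gram ℝ (fun i : b.support => P.root i) *
        Matrix.diagonal fun i : b.support => 2 / ⟪P.root i, P.root i⟫_ℝ := by
    ext i j
    rw [Matrix.mul_diagonal, Matrix.map_apply, Matrix.gram_apply]
    change (P.pairingIn ℤ i j : ℝ) = _
    rw [← inner_dualRoot_root_eq, dualRoot, real_inner_smul_left, mul_comm, real_inner_comm]
  have h2 : ((connectionIndex b : ℤ) : ℝ) = (b.cartanMatrix.map (Int.cast : ℤ → ℝ)).det := by
    rw [connectionIndex, Int.cast_det]
  have h3 : (0 : ℝ) < connectionIndex b := by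
    rw [h2, h1, Matrix.det_mul, Matrix.det_diagonal]
    exact mul_pos hG.det_pos (Finset.prod_pos fun i _ =>
      div_pos two_pos (inner_root_self_pos P i))
  exact_mod_cast h3

/-- The index of `Q^∨` in `(1/M) P^∨` is `c M ^ n`. -/
theorem relIndex_dualRootLattice {M : ℕ} (hM : 0 < M) :
    ((dualRootLattice b).relIndex (refinedLattice b M) : ℤ) =
      connectionIndex b * (M : ℤ) ^ Module.finrank ℝ V := by
  classical
  have h1 : dualRootLattice b = AddSubgroup.closure (Set.range (simpleDualBasis b)) := by
    rw [range_simpleDualBasis]; rfl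
  rw [AddSubgroup.relIndex_eq_natAbs_det _ _ (dualRootLattice_le_refinedLattice b M)
    ((simpleDualBasis b).addSubgroupOfClosure _ h1)
    ((refinedBasis b hM).addSubgroupOfClosure _ (refinedLattice_eq_closure b hM)),
    Module.Basis.det_apply]
  -- The coordinates of a simple dual root in the scaled fundamental dual weights are M times its
  -- pairings with the simple roots.
  have h2 : (((refinedBasis b hM).addSubgroupOfClosure _
      (refinedLattice_eq_closure b hM)).toMatrix fun i =>
        ⟨(simpleDualBasis b).addSubgroupOfClosure _ h1 i,
          dualRootLattice_le_refinedLattice b M (SetLike.coe_mem _)⟩) =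
      (M : ℤ) • b.cartanMatrix := by
    ext i j
    have h3 : (algebraMap ℤ ℝ) (((refinedBasis b hM).addSubgroupOfClosure _
        (refinedLattice_eq_closure b hM)).repr
        ⟨(simpleDualBasis b).addSubgroupOfClosure _ h1 j,
          dualRootLattice_le_refinedLattice b M (SetLike.coe_mem _)⟩ i) =
        (refinedBasis b hM).repr (simpleDualBasis b j) i :=
      (Module.Basis.addSubgroupOfClosure_repr_apply _ _ _ _ _).trans
        (by rw [Module.Basis.addSubgroupOfClosure_apply])
    rw [refinedBasis_repr, simpleDualBasis_apply, inner_dualRoot_root_eq] at h3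
    rw [Module.Basis.toMatrix_apply]
    have h4 : ((M : ℤ) • b.cartanMatrix) i j = M * P.pairingIn ℤ i j := rfl
    rw [h4]
    have h5 : (algebraMap ℤ ℝ) (M * P.pairingIn ℤ i j) = M * (P.pairingIn ℤ i j : ℝ) := by simp
    exact (algebraMap ℤ ℝ).injective_int (h3.trans h5.symm)
  rw [h2, Matrix.det_smul, Fintype.card_coe, Module.finrank_eq_card_basis b.toWeightBasis,
    Fintype.card_coe, Int.natAbs_mul, Nat.cast_mul, Int.natAbs_pow, Int.natAbs_natCast]
  have h6 : connectionIndex b = b.cartanMatrix.det := by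
    rw [connectionIndex]
  rw [← h6, Int.natAbs_of_nonneg (connectionIndex_pos b).le, mul_comm]
  push_cast
  rfl

end Index

/-! ### Strict fundamental domains for the even affine groups -/

section EvenDomain

variable {V : Type*} [NormedAddCommGroup V] [InnerProductSpace ℝ V]
  {W : Subgroup (V ≃ₗ[ℝ] V)} {L : AddSubgroup V} (hL : ∀ w ∈ W, ∀ x ∈ L, w x ∈ L)

/-- `F` meets every orbit of `L ⋊ W` in exactly one point. -/
structure IsStrictDomain (W : Subgroup (V ≃ₗ[ℝ] V)) (L : AddSubgroup V) (F : Set V) : Prop where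
  exists_mem (x : V) : ∃ w ∈ W, ∃ q ∈ L, w x + q ∈ F
  eq_of_mem {x q : V} {w : V ≃ₗ[ℝ] V} : w ∈ W → q ∈ L → x ∈ F → w x + q ∈ F → w x + q = x

/-- The affine map `x ↦ w x + q` as an element of `L ⋊ W`. -/
def toAffineGroup {w : V ≃ₗ[ℝ] V} (hw : w ∈ W) {q : V} (hq : q ∈ L) : affineGroup hL :=
  ⟨w.toAffineEquiv.trans (AffineEquiv.constVAdd ℝ V q), by
    refine ⟨?_, ?_⟩
    · exact hw
    · simpa using hq⟩

lemma toAffineGroup_apply {w : V ≃ₗ[ℝ] V} (hw : w ∈ W) {q : V} (hq : q ∈ L) (x : V) :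
    (toAffineGroup hL hw hq).1 x = w x + q := by
  simp [toAffineGroup, add_comm]

lemma retraction_toAffineGroup {w : V ≃ₗ[ℝ] V} (hw : w ∈ W) {q : V} (hq : q ∈ L) :
    retraction hL (toAffineGroup hL hw hq) = ⟨w, hw⟩ := by
  apply Subtype.ext
  rfl

variable {hL}

lemma affineGroup_apply (g : affineGroup hL) (x : V) :
    g.1 x = (retraction hL g).1 x + g.1 0 := by
  have := g.1.map_vadd 0 x
  rwa [vadd_eq_add, add_zero] at this

lemma IsStrictDomain.apply_eq {F : Set V} (hF : IsStrictDomain W L F) (g : affineGroup hL) {x : V}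
    (hx : x ∈ F) (hg : g.1 x ∈ F) : g.1 x = x := by
  rw [affineGroup_apply] at hg ⊢
  exact hF.eq_of_mem (retraction hL g).2 g.2.2 hx hg

lemma IsStrictDomain.exists_apply_mem {F : Set V} (hF : IsStrictDomain W L F)
    (hL : ∀ w ∈ W, ∀ x ∈ L, w x ∈ L) (x : V) : ∃ g : affineGroup hL, g.1 x ∈ F := by
  obtain ⟨w, hw, q, hq, h⟩ := hF.exists_mem x
  exact ⟨toAffineGroup hL hw hq, by rwa [toAffineGroup_apply]⟩

lemma mem_signDomain_iff {F : Set V} {σ : W →* ℤˣ} {a : V} :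
    a ∈ signDomain hL F σ ↔
      a ∈ F ∧ ∀ g : affineGroup hL, g.1 a = a → σ (retraction hL g) = 1 := by
  have h1 : ∀ g : affineGroup hL, g ∈ evenStab hL 1 a ↔ g.1 a = a := fun g =>
    ⟨fun h => h.2, fun h => ⟨rfl, h⟩⟩
  refine and_congr_right fun _ => ⟨fun h g hg => ?_, fun h => ?_⟩
  · have : σ (retraction hL g) ∈ ({1} : Set ℤˣ) := h ▸ ⟨g, (h1 g).mpr hg, rfl⟩
    exact this
  · refine Set.Subset.antisymm ?_ ?_
    · rintro - ⟨g, hg, rfl⟩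
      exact h g ((h1 g).mp hg)
    · rintro - rfl
      exact ⟨1, (h1 1).mpr rfl, by simp⟩

/-- The set `F ∪ r F^σ` meets every orbit of the even affine group in exactly one point. -/
theorem IsStrictDomain.evenDomain {F : Set V} (hF : IsStrictDomain W L F) (σ : W →* ℤˣ)
    (r : affineGroup hL) (hr : σ ≠ 1 → σ (retraction hL r) = -1) :
    IsStrictDomain (σ.ker.map W.subtype) L (evenDomain hL F σ r) := by
  have hmem : ∀ {x : V}, x ∈ EvenOrbit.evenDomain hL F σ r ↔
      x ∈ F ∨ (σ ≠ 1 ∧ ∃ a ∈ signDomain hL F σ, r.1 a = x) := by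
    intro x
    by_cases hσ : σ = 1 <;> simp [EvenOrbit.evenDomain, hσ]
  have hr' : σ ≠ 1 → σ (retraction hL r⁻¹) = -1 := fun h => by
    rw [map_inv, map_inv, hr h]; rfl
  have hrinv : ∀ x, r⁻¹.1 (r.1 x) = x := fun x => r.1.symm_apply_apply x
  have hmulapp : ∀ (g h : affineGroup hL) (x : V), (g * h).1 x = g.1 (h.1 x) := fun _ _ _ => rfl
  constructor
  · intro x
    have key : ∃ g : affineGroup hL, σ (retraction hL g) = 1 ∧
        g.1 x ∈ EvenOrbit.evenDomain hL F σ r := by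
      obtain ⟨g, hg⟩ := hF.exists_apply_mem hL x
      rcases Int.units_eq_one_or (σ (retraction hL g)) with h1 | h1
      · exact ⟨g, h1, hmem.mpr (Or.inl hg)⟩
      have hσ : σ ≠ 1 := by
        rintro rfl
        exact absurd h1 (by simp)
      -- Here g has sign -1. It is corrected by r if the isotropy group of g x has only sign 1, and
      -- otherwise by an isotropy element of sign -1.
      by_cases hs : g.1 x ∈ signDomain hL F σ
      · refine ⟨r * g, ?_, hmem.mpr (Or.inr ⟨hσ, g.1 x, hs, rfl⟩)⟩
        rw [map_mul, map_mul, hr hσ, h1]; rfl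
      · rw [mem_signDomain_iff] at hs
        push Not at hs
        obtain ⟨h, hh, hh'⟩ := hs hg
        refine ⟨h * g, ?_, ?_⟩
        · rw [map_mul, map_mul, (Int.units_eq_one_or _).resolve_left hh', h1]; rfl
        · rw [hmulapp, hh]
          exact hmem.mpr (Or.inl hg)
    obtain ⟨g, hg, hgx⟩ := key
    refine ⟨(retraction hL g).1, ⟨_, hg, rfl⟩, g.1 0, g.2.2, ?_⟩
    rwa [← affineGroup_apply]
  · rintro x q - ⟨w, hw, rfl⟩ hq hx hy
    have key : ∀ g : affineGroup hL, σ (retraction hL g) = 1 → g.1 x ∈ EvenOrbit.evenDomain hL F σ r →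
        g.1 x = x := by
      intro g hg hgx
      rw [hmem] at hx hgx
      rcases hx with hx | ⟨hσ, a, ha, rfl⟩
      · rcases hgx with hgx | ⟨hσ, c, hc, hcx⟩
        · exact hF.apply_eq g hx hgx
        -- Strictness of F identifies x with c, so r⁻¹ g fixes c with sign -1, against c lying in
        -- F^σ. The opposite mixed case is excluded in the same way by g r.
        · exfalso
          have h1 : (r⁻¹ * g).1 x = c := by rw [hmulapp, ← hcx, hrinv]
          rw [mem_signDomain_iff] at hc
          have h2 := hF.apply_eq (r⁻¹ * g) hx (by rw [h1]; exact hc.1)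
          rw [h1] at h2
          subst h2
          have h3 := hc.2 _ h1
          rw [map_mul, map_mul, hr' hσ, hg] at h3
          exact absurd h3 (by decide)
      · rw [mem_signDomain_iff] at ha
        rcases hgx with hgx | ⟨-, c, hc, hcx⟩
        · exfalso
          have h2 := hF.apply_eq (g * r) ha.1 hgx
          have h3 := ha.2 _ h2
          rw [map_mul, map_mul, hr hσ, hg] at h3
          exact absurd h3 (by decide)
        · rw [mem_signDomain_iff] at hc
          have h1 : (r⁻¹ * (g * r)).1 a = c := by
            rw [hmulapp, hmulapp, ← hcx, hrinv]
          have h2 := hF.apply_eq (r⁻¹ * (g * r)) ha.1 (by rw [h1]; exact hc.1)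
          rw [← hcx, ← h1, h2]
    have := key (toAffineGroup hL w.2 hq) (by rw [retraction_toAffineGroup]; exact hw)
      (by rwa [toAffineGroup_apply])
    rwa [toAffineGroup_apply] at this

/-- The isotropy group of `a` in `L ⋊ W^σ` projects bijectively onto its image in `W^σ`. -/
def evenStabEquiv (hL : ∀ w ∈ W, ∀ x ∈ L, w x ∈ L) (σ : W →* ℤˣ) (a : V) :
    evenStab hL σ a ≃ {k : σ.ker // k.1.1 a - a ∈ L} where
  toFun g := ⟨⟨retraction hL g.1, g.2.1⟩, by
    have h1 := affineGroup_apply g.1 a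
    rw [g.2.2] at h1
    change (retraction hL g.1).1 a - a ∈ L
    have h2 : (retraction hL g.1).1 a - a = -(g.1.1 0) := by
      linear_combination (norm := module) (-1 : ℤ) • h1
    rw [h2]
    exact L.neg_mem g.1.2.2⟩
  invFun k := ⟨toAffineGroup hL k.1.1.2 (L.neg_mem k.2), by
    refine ⟨?_, ?_⟩
    · change σ (retraction hL _) = 1
      rw [retraction_toAffineGroup]
      exact k.1.2
    · rw [toAffineGroup_apply]
      abel⟩
  left_inv g := by
    apply Subtype.ext
    apply Subtype.ext
    ext x
    rw [toAffineGroup_apply, affineGroup_apply g.1 x, add_right_inj]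
    have h1 := affineGroup_apply g.1 a
    rw [g.2.2] at h1
    change -((retraction hL g.1).1 a - a) = _
    linear_combination (norm := module) (1 : ℤ) • h1
  right_inv k := by
    apply Subtype.ext
    apply Subtype.ext
    exact retraction_toAffineGroup hL k.1.1.2 (L.neg_mem k.2)

end EvenDomain

/-! ### From weighted sums over a domain to sums over the quotient -/

section OrbitSum

variable {V : Type*} [NormedAddCommGroup V] [InnerProductSpace ℝ V]
  {W : Subgroup (V ≃ₗ[ℝ] V)} {L : AddSubgroup V}

/-- Points congruent modulo L lie in one orbit (take w = 1), so the domain embeds in the finite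
quotient. -/
lemma finite_inter_strictDomain {W : Subgroup (V ≃ₗ[ℝ] V)} {D : Set V} (hD : IsStrictDomain W L D)
    (X : AddSubgroup V) [Finite (X ⧸ L.addSubgroupOf X)] : ((X : Set V) ∩ D).Finite := by
  classical
  refine Set.Finite.of_injOn (f := fun x => if h : x ∈ X then
    (QuotientAddGroup.mk ⟨x, h⟩ : X ⧸ L.addSubgroupOf X) else 0) (t := Set.univ)
    (fun _ _ => Set.mem_univ _) ?_ Set.finite_univ
  rintro x ⟨hx, hxD⟩ y ⟨hy, hyD⟩ h
  have hx' : x ∈ X := hx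
  have hy' : y ∈ X := hy
  simp only [hx', hy', dif_pos] at h
  rw [QuotientAddGroup.eq] at h
  have h' : -x + y ∈ L := h
  have := hD.eq_of_mem (one_mem W) h' hxD (by simpa using hyD)
  simpa using this.symm

/-- Summing over a strict fundamental domain of `L ⋊ W^σ`, with each point weighted by the size of
its orbit modulo `L`, is summing modulo `L`. -/
theorem sum_strictDomain_eq_sum_quotient (hL : ∀ w ∈ W, ∀ x ∈ L, w x ∈ L) (σ : W →* ℤˣ)
    [Finite W] {D : Set V} (hD : IsStrictDomain (σ.ker.map W.subtype) L D)
    (X : AddSubgroup V) (hLX : L ≤ X) (hX : ∀ w ∈ W, ∀ x ∈ X, w x ∈ X)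
    [Fintype (X ⧸ L.addSubgroupOf X)] (f : V → ℂ)
    (hf : ∀ k : σ.ker, ∀ q ∈ L, ∀ x ∈ X, f (k.1.1 x + q) = f x) :
    ∑ᶠ a ∈ (X : Set V) ∩ D, ((Nat.card σ.ker : ℝ) / (Nat.card (evenStab hL σ a) : ℝ) : ℝ) * f a =
      ∑ s : X ⧸ L.addSubgroupOf X, f (s.out : X) := by
  classical
  have := Fintype.ofFinite σ.ker
  have hout : ∀ (x : V) (hx : x ∈ X) (s : X ⧸ L.addSubgroupOf X),
      x - (s.out : X) ∈ L ↔ s = QuotientAddGroup.mk ⟨x, hx⟩ := by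
    intro x hx s
    conv_rhs => rw [← QuotientAddGroup.out_eq' s, QuotientAddGroup.eq]
    rw [AddSubgroup.mem_addSubgroupOf, sub_eq_neg_add]
    rfl
  -- The elements that carry a to the class of y form a left coset of the projected isotropy group.
  have hcount : ∀ a (k₀ : σ.ker) (y : V), k₀.1.1 a - y ∈ L →
      (Finset.univ.filter fun k : σ.ker => k.1.1 a - y ∈ L).card =
        Nat.card (evenStab hL σ a) := by
    intro a k₀ y h0
    rw [Nat.card_congr (evenStabEquiv hL σ a), Nat.card_eq_fintype_card, Fintype.card_subtype]
    refine Finset.card_bij' (fun k _ => k₀⁻¹ * k) (fun k _ => k₀ * k) ?_ ?_ ?_ ?_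
    · intro k hk
      simp only [Finset.mem_filter, Finset.mem_univ, true_and] at hk ⊢
      have h1 := hL _ (k₀⁻¹).1.2 _ (L.sub_mem hk h0)
      rw [sub_sub_sub_cancel_right, map_sub] at h1
      have h2 : (k₀⁻¹).1.1 (k₀.1.1 a) = a := k₀.1.1.symm_apply_apply a
      rw [h2] at h1
      exact h1
    · intro k hk
      simp only [Finset.mem_filter, Finset.mem_univ, true_and] at hk ⊢
      have h1 := hL _ k₀.1.2 _ hk
      rw [map_sub] at h1
      have h2 := L.add_mem h1 h0
      rw [sub_add_sub_cancel] at h2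
      exact h2
    · intro k _; simp
    · intro k _; simp
  have hstab : ∀ a, (Nat.card (evenStab hL σ a) : ℂ) ≠ 0 := by
    intro a
    have h1 := hcount a 1 a (by simp)
    rw [← h1, Nat.cast_ne_zero]
    refine (Finset.card_pos.mpr ⟨1, ?_⟩).ne'
    simp
  have hfin := finite_inter_strictDomain hD X
  rw [finsum_mem_eq_finite_toFinset_sum _ hfin]
  -- Double counting of triples (a, s, k) with k a in the class s, each with weight f a / |Stab a|.
  -- For fixed a, every k determines one s.
  have hsplit : ∀ a ∈ hfin.toFinset, (((Nat.card σ.ker : ℝ) /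
      (Nat.card (evenStab hL σ a) : ℝ) : ℝ) : ℂ) * f a =
      ∑ s : X ⧸ L.addSubgroupOf X, ∑ k : σ.ker,
        if k.1.1 a - (s.out : X) ∈ L then f a / (Nat.card (evenStab hL σ a) : ℂ) else 0 := by
    intro a ha
    have haX : a ∈ X := ((Set.Finite.mem_toFinset _).mp ha).1
    rw [Finset.sum_comm]
    have : ∀ k : σ.ker, (∑ s : X ⧸ L.addSubgroupOf X,
        if k.1.1 a - (s.out : X) ∈ L then f a / (Nat.card (evenStab hL σ a) : ℂ) else 0) =
        f a / (Nat.card (evenStab hL σ a) : ℂ) := by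
      intro k
      simp only [hout _ (hX _ k.1.2 _ haX), Finset.sum_ite_eq',
        Finset.mem_univ, if_true]
    simp only [this]
    rw [Finset.sum_const, Finset.card_univ, Nat.card_eq_fintype_card, nsmul_eq_mul]
    push_cast
    ring
  rw [Finset.sum_congr rfl hsplit, Finset.sum_comm]
  refine Finset.sum_congr rfl fun s _ => ?_
  obtain ⟨w, hw, q, hq, hmem⟩ := hD.exists_mem (s.out : X)
  obtain ⟨k, hk, rfl⟩ := hw
  set a : V := (W.subtype k) ((s.out : X) : V) + q with ha
  have haX : a ∈ X := X.add_mem (hX _ k.2 _ s.out.2) (hLX hq)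
  have hk0 : ((⟨k, hk⟩ : σ.ker)⁻¹).1.1 a - (s.out : X) ∈ L := by
    have h2 : ((⟨k, hk⟩ : σ.ker)⁻¹).1.1 (k.1 ((s.out : X) : V)) = (s.out : X) :=
      k.1.symm_apply_apply _
    rw [ha, map_add]
    change ((⟨k, hk⟩ : σ.ker)⁻¹).1.1 (k.1 ((s.out : X) : V)) + _ - _ ∈ L
    rw [h2, add_sub_cancel_left]
    exact hL _ ((⟨k, hk⟩ : σ.ker)⁻¹).1.2 _ hq
  -- For fixed s only the representative a of its orbit contributes, through a whole coset, which
  -- cancels |Stab a|.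
  rw [Finset.sum_eq_single a]
  · rw [← Finset.sum_filter, Finset.sum_const, hcount a _ _ hk0, nsmul_eq_mul,
      mul_div_cancel₀ _ (hstab a)]
    exact hf ⟨k, hk⟩ q hq _ s.out.2
  · intro a' ha' hne
    refine Finset.sum_eq_zero fun k' _ => if_neg fun h => hne ?_
    have ha'D : a' ∈ D := ((Set.Finite.mem_toFinset _).mp ha').2
    have h1 : (k.1 * k'.1.1) a' + (q - k.1 (k'.1.1 a' - (s.out : X))) = a := by
      rw [ha, map_sub]
      change k.1 (k'.1.1 a') + _ = k.1 _ + q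
      abel
    have hkk : k.1 * k'.1.1 ∈ σ.ker.map W.subtype :=
      Subgroup.mem_map_of_mem W.subtype (σ.ker.mul_mem hk k'.2)
    have h2 := hD.eq_of_mem (x := a') (q := q - k.1 (k'.1.1 a' - (s.out : X)))
      (w := k.1 * k'.1.1) hkk
      (L.sub_mem hq (hL _ k.2 _ h)) ha'D (by rw [h1]; exact hmem)
    rw [← h2, h1]
  · intro h
    exact absurd (hfin.mem_toFinset.mpr ⟨haX, hmem⟩) h

end OrbitSum

/-! ### Characters of (1/M) P^∨ / Q^∨ -/

section Characters

/-- The function `x ↦ exp(2πix)`. -/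
def expTwoPi (x : ℝ) : ℂ := Complex.exp (2 * Real.pi * Complex.I * (x : ℂ))

lemma expTwoPi_add (x y : ℝ) : expTwoPi (x + y) = expTwoPi x * expTwoPi y := by
  rw [expTwoPi, expTwoPi, expTwoPi, ← Complex.exp_add]
  push_cast
  ring_nf

lemma expTwoPi_eq_one_iff (x : ℝ) : expTwoPi x = 1 ↔ ∃ k : ℤ, x = k := by
  rw [expTwoPi, Complex.exp_eq_one_iff]
  refine exists_congr fun k => ?_
  rw [mul_comm, mul_left_inj' Complex.two_pi_I_ne_zero]
  norm_cast

lemma conj_expTwoPi (x : ℝ) : (starRingEnd ℂ) (expTwoPi x) = expTwoPi (-x) := by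
  rw [expTwoPi, expTwoPi, ← Complex.exp_conj]
  congr 1
  simp only [map_mul, Complex.conj_ofReal, Complex.conj_I, map_ofNat, Complex.ofReal_neg]
  ring

variable {ι V N : Type*} [NormedAddCommGroup V] [InnerProductSpace ℝ V]
  [AddCommGroup N] [Module ℝ N] {P : RootPairing ι ℝ V N} (b : P.Base)

lemma inner_weylGroup_apply [IsEuclidean P] {w : V ≃ₗ[ℝ] V} (hw : w ∈ weylGroup b) :
    ∀ x y, ⟪w x, w y⟫_ℝ = ⟪x, y⟫_ℝ := by
  induction hw using Subgroup.closure_induction'' with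
  | mem w hw =>
    obtain ⟨i, -, rfl⟩ := hw
    exact IsEuclidean.inner_reflection i
  | inv_mem w hw =>
    obtain ⟨i, -, rfl⟩ := hw
    rw [P.reflection_inv]
    exact IsEuclidean.inner_reflection i
  | one => exact fun x y => rfl
  | mul w w' _ _ h h' => exact fun x y => (h _ _).trans (h' _ _)

lemma inner_weylGroup_left [IsEuclidean P] (w : weylGroup b) (x y : V) :
    ⟪w.1 x, y⟫_ℝ = ⟪x, (w⁻¹).1 y⟫_ℝ := by
  rw [← inner_weylGroup_apply b (w⁻¹).2 (w.1 x) y]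
  congr 1
  exact w.1.symm_apply_apply x

variable [P.IsCrystallographic]

lemma refinedLattice_stable [IsEuclidean P] (M : ℕ) :
    ∀ w ∈ weylGroup b, ∀ x ∈ refinedLattice b M, w x ∈ refinedLattice b M := by
  intro w hw x hx y hy
  obtain ⟨k, hk⟩ := hx _ (rootLattice_stable b _ ((⟨w, hw⟩ : weylGroup b)⁻¹).2 y hy)
  refine ⟨k, ?_⟩
  rw [← hk, real_inner_smul_left, real_inner_smul_left,
    ← inner_weylGroup_left b ⟨w, hw⟩]

lemma weylGroup_mem_weightLattice [IsEuclidean P] (w : weylGroup b) {β : V}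
    (hβ : β ∈ weightLattice b) : w.1 β ∈ weightLattice b := by
  intro q hq
  rw [inner_weylGroup_left]
  exact hβ _ (dualRootLattice_stable b _ (w⁻¹).2 q hq)

lemma sub_mem_weightLattice {β β' : V} (hβ : β ∈ weightLattice b) (hβ' : β' ∈ weightLattice b) :
    β - β' ∈ weightLattice b := by
  intro q hq
  obtain ⟨k, hk⟩ := hβ q hq
  obtain ⟨l, hl⟩ := hβ' q hq
  exact ⟨k - l, by rw [inner_sub_left, hk, hl]; push_cast; rfl⟩

lemma expTwoPi_inner_congr {lam x y : V} (hlam : lam ∈ weightLattice b)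
    (h : x - y ∈ dualRootLattice b) : expTwoPi ⟪lam, x⟫_ℝ = expTwoPi ⟪lam, y⟫_ℝ := by
  rw [← sub_add_cancel x y, inner_add_right, expTwoPi_add, (expTwoPi_eq_one_iff _).mpr (hlam _ h),
    one_mul]

variable [IsEuclidean P] [P.IsRootSystem]

-- The scaled fundamental dual weights are M⁻¹ times the basis dual to the simple roots, so pairing
-- with them reads off the coordinates of M⁻¹ λ.
omit [P.IsCrystallographic] [IsEuclidean P] in
lemma mem_rootLattice_of_inner_int {M : ℕ} (hM : 0 < M) {lam : V}
    (h : ∀ x ∈ refinedLattice b M, ∃ k : ℤ, ⟪lam, x⟫_ℝ = k) :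
    (M : ℝ)⁻¹ • lam ∈ rootLattice b := by
  have hM' : (M : ℝ) ≠ 0 := by exact_mod_cast hM.ne'
  rw [← b.toWeightBasis.sum_repr lam, Finset.smul_sum]
  refine AddSubgroup.sum_mem _ fun i _ => ?_
  obtain ⟨k, hk⟩ := h (refinedBasis b hM i) (by
    rw [refinedLattice_eq_closure b hM]
    exact AddSubgroup.subset_closure ⟨i, rfl⟩)
  have h1 : ⟪lam, refinedBasis b hM i⟫_ℝ = (M : ℝ)⁻¹ * b.toWeightBasis.repr lam i := by
    conv_lhs => rw [← b.toWeightBasis.sum_repr lam]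
    rw [sum_inner, Finset.sum_eq_single i]
    · have h2 := refinedBasis_repr b hM (refinedBasis b hM i) i
      rw [Module.Basis.repr_self, Finsupp.single_eq_same] at h2
      rw [real_inner_smul_left, b.toWeightBasis_apply, real_inner_comm, mul_comm,
        eq_inv_of_mul_eq_one_right h2.symm]
    · intro j _ hj
      have h2 := refinedBasis_repr b hM (refinedBasis b hM i) j
      rw [Module.Basis.repr_self, Finsupp.single_eq_of_ne hj] at h2
      rw [real_inner_smul_left, b.toWeightBasis_apply, real_inner_comm,
        (mul_eq_zero.mp h2.symm).resolve_left hM', mul_zero]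
    · simp
  rw [smul_smul, ← h1, hk, b.toWeightBasis_apply, Int.cast_smul_eq_zsmul ℝ]
  exact zsmul_mem (AddSubgroup.subset_closure (Set.mem_image_of_mem _ i.2)) k

open Classical in
/-- Orthogonality of the characters of `(1/M) P^∨ / Q^∨`. -/
theorem sum_expTwoPi_inner {M : ℕ} (hM : 0 < M)
    [Fintype (refinedLattice b M ⧸ (dualRootLattice b).addSubgroupOf (refinedLattice b M))]
    {lam : V} (hlam : lam ∈ weightLattice b) :
    ∑ s : refinedLattice b M ⧸ (dualRootLattice b).addSubgroupOf (refinedLattice b M),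
      expTwoPi ⟪lam, (s.out : refinedLattice b M)⟫_ℝ =
    if (M : ℝ)⁻¹ • lam ∈ rootLattice b then
      ((dualRootLattice b).relIndex (refinedLattice b M) : ℂ) else 0 := by
  have hM' : (M : ℝ) ≠ 0 := by exact_mod_cast hM.ne'
  -- The value does not depend on the representative, because a weight pairs integrally with Q^∨;
  -- additivity on the quotient follows from this.
  have hout : ∀ x : refinedLattice b M,
      expTwoPi ⟪lam, ((QuotientAddGroup.mk x :
        refinedLattice b M ⧸ (dualRootLattice b).addSubgroupOf (refinedLattice b M)).out :
          refinedLattice b M)⟫_ℝ = expTwoPi ⟪lam, x⟫_ℝ := by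
    intro x
    refine (expTwoPi_inner_congr b hlam ?_).symm
    have h := QuotientAddGroup.eq.mp (QuotientAddGroup.out_eq' (QuotientAddGroup.mk x :
        refinedLattice b M ⧸ (dualRootLattice b).addSubgroupOf (refinedLattice b M)))
    rw [sub_eq_neg_add]
    exact h
  let χ : AddChar (refinedLattice b M ⧸ (dualRootLattice b).addSubgroupOf (refinedLattice b M)) ℂ :=
    { toFun := fun s => expTwoPi ⟪lam, (s.out : refinedLattice b M)⟫_ℝ
      map_zero_eq_one' := by
        refine (hout 0).trans ?_
        rw [expTwoPi_eq_one_iff]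
        exact ⟨0, by simp⟩
      map_add_eq_mul' := by
        intro s s'
        induction s using QuotientAddGroup.induction_on with | _ x
        induction s' using QuotientAddGroup.induction_on with | _ x'
        rw [← QuotientAddGroup.mk_add, hout, hout, hout, ← expTwoPi_add, ← inner_add_right]
        rfl }
  change ∑ s, χ s = _
  rw [AddChar.sum_eq_ite]
  have hχ : χ = 0 ↔ (M : ℝ)⁻¹ • lam ∈ rootLattice b := by
    constructor
    · intro h
      refine mem_rootLattice_of_inner_int b hM fun x hx => ?_
      rw [← expTwoPi_eq_one_iff, ← hout ⟨x, hx⟩]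
      exact DFunLike.congr_fun h _
    · intro h
      ext s
      change expTwoPi _ = 1
      rw [expTwoPi_eq_one_iff]
      obtain ⟨k, hk⟩ := s.out.2 _ h
      refine ⟨k, ?_⟩
      rw [← hk, real_inner_smul_left, real_inner_smul_right, mul_inv_cancel_left₀ hM',
        real_inner_comm]
  simp only [hχ]
  congr 1
  rw [AddSubgroup.relIndex, AddSubgroup.index, Nat.card_eq_fintype_card]

end Characters

/-! ### Symmetry and products of orbit functions -/

section OrbitFunctions

variable {ι V N : Type*} [NormedAddCommGroup V] [InnerProductSpace ℝ V]
  [AddCommGroup N] [Module ℝ N] {P : RootPairing ι ℝ V N} (b : P.Base)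
  [Finite ι] [P.IsRootSystem] [P.IsCrystallographic] [IsEuclidean P]
  (τ σ : weylGroup b →* ℤˣ)

omit [P.IsCrystallographic] [IsEuclidean P] in
lemma orbitFunction_eq [Fintype σ.ker] (β a : V) :
    orbitFunction b τ σ β a =
      ∑ w : σ.ker, (((τ w.1 : ℤˣ) : ℤ) : ℂ) * expTwoPi ⟪w.1.1 β, a⟫_ℝ := by
  rw [orbitFunction]
  congr!

/-- Reindexing the sum by w ↦ k w produces the sign, and the translation q is invisible to weights.
-/
lemma orbitFunction_apply_even {β : V} (hβ : β ∈ weightLattice b) (k : σ.ker) {q : V}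
    (hq : q ∈ dualRootLattice b) (a : V) :
    orbitFunction b τ σ β (k.1.1 a + q) =
      (((τ k.1 : ℤˣ) : ℤ) : ℂ) * orbitFunction b τ σ β a := by
  have := Fintype.ofFinite σ.ker
  rw [orbitFunction_eq, orbitFunction_eq, Finset.mul_sum]
  refine (Fintype.sum_equiv (Equiv.mulLeft k) _ _ fun w => ?_).symm
  change _ = (((τ (k.1 * w.1) : ℤˣ) : ℤ) : ℂ) * expTwoPi ⟪k.1.1 (w.1.1 β), k.1.1 a + q⟫_ℝ
  have h : expTwoPi ⟪k.1.1 (w.1.1 β), k.1.1 a + q⟫_ℝ = expTwoPi ⟪w.1.1 β, a⟫_ℝ := by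
    rw [expTwoPi_inner_congr b (y := k.1.1 a) (weylGroup_mem_weightLattice b k.1
      (weylGroup_mem_weightLattice b w.1 hβ)) (by simpa using hq),
      inner_weylGroup_apply b k.1.2]
  rw [h, map_mul]
  push_cast
  ring

/-- An isotropy element of sign -1 under τ makes the value at a equal to its own negative. -/
lemma orbitFunction_eq_zero_of_mem_boundary {β : V} (hβ : β ∈ weightLattice b) {F : Set V}
    {r : affineWeylGroup b} {a : V} (ha : a ∈ boundary (dualRootLattice_stable b) F τ σ r) :
    orbitFunction b τ σ β a = 0 := by
  obtain ⟨g, ⟨hg, hga⟩, hτ⟩ : (-1 : ℤˣ) ∈ (fun g => τ (retraction (dualRootLattice_stable b) g)) ''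
      evenStab (dualRootLattice_stable b) σ a := by
    rw [ha.2]; simp
  have h := orbitFunction_apply_even b τ σ hβ ⟨retraction (dualRootLattice_stable b) g, hg⟩ g.2.2 a
  rw [← affineGroup_apply, hga] at h
  have hτ' : τ (retraction (dualRootLattice_stable b) g) = -1 := hτ
  rw [hτ'] at h
  push_cast at h
  have h2 : (2 : ℂ) * orbitFunction b τ σ β a = 0 := by linear_combination h
  simpa using h2

-- An isotropy element of sign -1, together with the identity, would make τ take both values on the
-- isotropy group and put y in the boundary.
omit [P.IsRootSystem] [IsEuclidean P] [Finite ι] in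
lemma sign_eq_one_of_mem_domain {F : Set V} {r : dualAffineWeylGroup b} {y : V}
    (hy : y ∈ domain (rootLattice_stable b) F τ σ r) {k : σ.ker}
    (hk : k.1.1 y - y ∈ rootLattice b) : τ k.1 = 1 := by
  set g := (evenStabEquiv (rootLattice_stable b) σ y).symm ⟨k, hk⟩
  have hg : retraction (rootLattice_stable b) g.1 = k.1 :=
    congrArg (fun k => k.1.1) ((evenStabEquiv (rootLattice_stable b) σ y).apply_symm_apply ⟨k, hk⟩)
  by_contra hne
  refine hy.2 ⟨hy.1, Set.Subset.antisymm ?_ ?_⟩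
  · rintro - ⟨g, -, rfl⟩
    exact Int.units_eq_one_or _
  · rintro - (rfl | rfl)
    · exact ⟨1, ⟨one_mem _, rfl⟩, by simp⟩
    · refine ⟨g.1, g.2, ?_⟩
      change τ (retraction (rootLattice_stable b) g.1) = -1
      rw [hg]
      exact (Int.units_eq_one_or _).resolve_left hne

open Classical in
theorem sum_orbitFunction_mul_conj [Fintype σ.ker] {M : ℕ} (hM : 0 < M)
    [Fintype (refinedLattice b M ⧸ (dualRootLattice b).addSubgroupOf (refinedLattice b M))]
    {β β' : V} (hβ : β ∈ weightLattice b) (hβ' : β' ∈ weightLattice b) :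
    ∑ s : refinedLattice b M ⧸ (dualRootLattice b).addSubgroupOf (refinedLattice b M),
      orbitFunction b τ σ β (s.out : refinedLattice b M) *
        (starRingEnd ℂ) (orbitFunction b τ σ β' (s.out : refinedLattice b M)) =
    (Nat.card σ.ker : ℂ) * ∑ u : σ.ker, (((τ u.1 : ℤˣ) : ℤ) : ℂ) *
      if (M : ℝ)⁻¹ • β - u.1.1 ((M : ℝ)⁻¹ • β') ∈ rootLattice b then
        ((dualRootLattice b).relIndex (refinedLattice b M) : ℂ) else 0 := by
  have h1 : ∀ x : V, orbitFunction b τ σ β x * (starRingEnd ℂ) (orbitFunction b τ σ β' x) =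
      ∑ w : σ.ker, ∑ w' : σ.ker, (((τ w.1 : ℤˣ) : ℤ) : ℂ) * (((τ w'.1 : ℤˣ) : ℤ) : ℂ) *
        expTwoPi ⟪w.1.1 β - w'.1.1 β', x⟫_ℝ := by
    intro x
    rw [orbitFunction_eq, orbitFunction_eq, map_sum, Finset.sum_mul_sum]
    refine Finset.sum_congr rfl fun w _ => Finset.sum_congr rfl fun w' _ => ?_
    rw [map_mul, conj_expTwoPi, inner_sub_left, sub_eq_add_neg, expTwoPi_add]
    simp only [map_intCast]
    ring
  simp only [h1]
  rw [Finset.sum_comm]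
  have h2 : ∀ w : σ.ker, (∑ s : refinedLattice b M ⧸
      (dualRootLattice b).addSubgroupOf (refinedLattice b M), ∑ w' : σ.ker,
        (((τ w.1 : ℤˣ) : ℤ) : ℂ) * (((τ w'.1 : ℤˣ) : ℤ) : ℂ) *
          expTwoPi ⟪w.1.1 β - w'.1.1 β', (s.out : refinedLattice b M)⟫_ℝ) =
      ∑ u : σ.ker, (((τ u.1 : ℤˣ) : ℤ) : ℂ) *
        if (M : ℝ)⁻¹ • β - u.1.1 ((M : ℝ)⁻¹ • β') ∈ rootLattice b then
          ((dualRootLattice b).relIndex (refinedLattice b M) : ℂ) else 0 := by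
    intro w
    rw [Finset.sum_comm]
    -- With w' = w u the product of the signs is τ u and w factors out of the lattice condition, so
    -- the inner sum does not depend on w.
    refine (Fintype.sum_equiv (Equiv.mulLeft w) _ _ fun u => ?_).symm
    rw [← Finset.mul_sum, sum_expTwoPi_inner b hM (sub_mem_weightLattice b
      (weylGroup_mem_weightLattice b _ hβ) (weylGroup_mem_weightLattice b _ hβ'))]
    have h3 : (M : ℝ)⁻¹ • (w.1.1 β - (Equiv.mulLeft w u).1.1 β') =
        w.1.1 ((M : ℝ)⁻¹ • β - u.1.1 ((M : ℝ)⁻¹ • β')) := by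
      rw [map_smul, map_sub, map_smul, map_smul, ← smul_sub]
      rfl
    have h4 : (M : ℝ)⁻¹ • (w.1.1 β - (Equiv.mulLeft w u).1.1 β') ∈ rootLattice b ↔
        (M : ℝ)⁻¹ • β - u.1.1 ((M : ℝ)⁻¹ • β') ∈ rootLattice b := by
      rw [h3]
      refine ⟨fun h => ?_, rootLattice_stable b _ w.1.2 _⟩
      have := rootLattice_stable b _ (w.1⁻¹).2 _ h
      rwa [show (w.1⁻¹).1 (w.1.1 ((M : ℝ)⁻¹ • β - u.1.1 ((M : ℝ)⁻¹ • β'))) = _ from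
        w.1.1.symm_apply_apply _] at this
    have h5 : τ w.1 * τ (Equiv.mulLeft w u).1 = τ u.1 := by
      change τ w.1 * τ (w.1 * u.1) = _
      rw [map_mul, ← mul_assoc, Int.units_mul_self, one_mul]
    simp only [h4]
    rw [← Int.cast_mul, ← Units.val_mul, h5]
  rw [Finset.sum_congr rfl fun w _ => h2 w, Finset.sum_const, Finset.card_univ,
    Nat.card_eq_fintype_card, nsmul_eq_mul]

end OrbitFunctions

end EvenOrbit

end
-- The orthogonality relation
open EvenOrbit in
open Classical in
theorem mainTheorem1 {ι V N : Type*} [Finite ι] [NormedAddCommGroup V] [InnerProductSpace ℝ V]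
    [AddCommGroup N] [Module ℝ N]
    (P : RootPairing ι ℝ V N) [P.IsRootSystem] [P.IsCrystallographic] [P.IsReduced]
    [P.IsIrreducible] [IsEuclidean P] (b : P.Base)
    (τ σ : weylGroup b →* ℤˣ)
    (r : affineWeylGroup b) (hr : σ ≠ 1 → r ∈ negReflections b σ)
    (r' : dualAffineWeylGroup b) (hr' : σ ≠ 1 → r' ∈ dualNegReflections b σ)
    (M : ℕ) (hM : 0 < M) :
    (pointSet b τ σ r M).Finite ∧
    ∀ β ∈ labelSet b τ σ r' M, ∀ β' ∈ labelSet b τ σ r' M,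
      weightedProduct (pointSet b τ σ r M) (orbitWeight b σ)
          (orbitFunction b τ σ β) (orbitFunction b τ σ β') =
        (connectionIndex b : ℂ) * (Nat.card σ.ker : ℂ) * (M : ℂ) ^ (Module.finrank ℝ V) *
          (dualStabOrder b σ M β : ℂ) * (if β = β' then 1 else 0) := by
  have := finiteDimensional_of_base b
  have hM' : (M : ℝ) ≠ 0 := by exact_mod_cast hM.ne'
  have hD : IsStrictDomain (σ.ker.map (weylGroup b).subtype) (dualRootLattice b)
      (evenDomain (dualRootLattice_stable b) (simplex (Set.range P.root) (simpleRoots b)) σ r) :=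
    IsStrictDomain.evenDomain ⟨exists_mem_simplex b, eq_of_mem_simplex b⟩ σ r fun h => (hr h).2
  have hD' : IsStrictDomain (σ.ker.map (weylGroup b).subtype) (rootLattice b)
      (evenDomain (rootLattice_stable b)
        (simplex (Set.range (dualRoot P)) (simpleDualRoots b)) σ r') :=
    IsStrictDomain.evenDomain ⟨exists_mem_dual_simplex b, eq_of_mem_dual_simplex b⟩ σ r'
      fun h => (hr' h).2
  have hindex := relIndex_dualRootLattice b hM
  have hfinite : Finite (refinedLattice b M ⧸
      (dualRootLattice b).addSubgroupOf (refinedLattice b M)) := by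
    refine Nat.finite_of_card_ne_zero fun h0 => ?_
    have h1 : (dualRootLattice b).relIndex (refinedLattice b M) = 0 := h0
    rw [h1] at hindex
    have := mul_pos (connectionIndex_pos b)
      (pow_pos (show (0 : ℤ) < M by exact_mod_cast hM) (Module.finrank ℝ V))
    rw [← hindex] at this
    exact this.false
  have := Fintype.ofFinite (refinedLattice b M ⧸
    (dualRootLattice b).addSubgroupOf (refinedLattice b M))
  have := Fintype.ofFinite σ.ker
  have hpoint : pointSet b τ σ r M = (refinedLattice b M : Set V) ∩
      domain (dualRootLattice_stable b) (simplex (Set.range P.root) (simpleRoots b)) τ σ r := by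
    rw [coe_refinedLattice b hM]; rfl
  refine ⟨?_, ?_⟩
  · rw [hpoint]
    exact (finite_inter_strictDomain hD _).subset (Set.inter_subset_inter_right _ Set.sdiff_subset)
  rintro β ⟨hβ, hβD⟩ β' ⟨hβ', hβD'⟩
  rw [Set.mem_smul_set_iff_inv_smul_mem₀ hM'] at hβD hβD'
  have hsum : weightedProduct (pointSet b τ σ r M) (orbitWeight b σ)
      (orbitFunction b τ σ β) (orbitFunction b τ σ β') =
      ∑ s : refinedLattice b M ⧸ (dualRootLattice b).addSubgroupOf (refinedLattice b M),
        orbitFunction b τ σ β (s.out : refinedLattice b M) *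
          (starRingEnd ℂ) (orbitFunction b τ σ β' (s.out : refinedLattice b M)) := by
    rw [← sum_strictDomain_eq_sum_quotient (dualRootLattice_stable b) σ hD (refinedLattice b M)
      (dualRootLattice_le_refinedLattice b M) (refinedLattice_stable b M)
      (fun x => orbitFunction b τ σ β x * (starRingEnd ℂ) (orbitFunction b τ σ β' x))]
    · rw [weightedProduct, hpoint]
      simp only [mul_assoc]
      -- The boundary can be restored to the domain of summation, since the orbit functions vanish
      -- there.
      refine finsum_mem_inter_support_eq _ _ _ ?_
      ext a
      simp only [Set.mem_inter_iff, domain, Set.mem_sdiff, Function.mem_support]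
      constructor
      · rintro ⟨⟨h1, h2, h3⟩, h4⟩
        exact ⟨⟨h1, h2⟩, h4⟩
      · rintro ⟨⟨h1, h2⟩, h4⟩
        refine ⟨⟨h1, h2, fun h3 => h4 ?_⟩, h4⟩
        rw [orbitFunction_eq_zero_of_mem_boundary b τ σ hβ h3]
        simp
    · intro k q hq x _
      rw [orbitFunction_apply_even b τ σ hβ k hq, orbitFunction_apply_even b τ σ hβ' k hq]
      rcases Int.units_eq_one_or (τ k.1) with h | h <;> simp [h]
  rw [hsum, sum_orbitFunction_mul_conj b τ σ hM hβ hβ']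
  have hrel : ((dualRootLattice b).relIndex (refinedLattice b M) : ℂ) =
      connectionIndex b * (M : ℂ) ^ Module.finrank ℝ V := by
    exact_mod_cast congrArg (Int.cast : ℤ → ℂ) hindex
  split_ifs with hββ
  · subst hββ
    -- The surviving u come from the isotropy group of β/M, where τ is 1; what remains is their
    -- number, `dualStabOrder`.
    have h1 : ∀ u : σ.ker, ((((τ u.1 : ℤˣ) : ℤ) : ℂ) *
        if (M : ℝ)⁻¹ • β - u.1.1 ((M : ℝ)⁻¹ • β) ∈ rootLattice b then
          ((dualRootLattice b).relIndex (refinedLattice b M) : ℂ) else 0) =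
        if u.1.1 ((M : ℝ)⁻¹ • β) - (M : ℝ)⁻¹ • β ∈ rootLattice b then
          ((dualRootLattice b).relIndex (refinedLattice b M) : ℂ) else 0 := by
      intro u
      rw [← neg_mem_iff, neg_sub]
      split_ifs with h
      · rw [sign_eq_one_of_mem_domain b τ σ hβD h]
        simp
      · simp
    rw [Finset.sum_congr rfl fun u _ => h1 u, ← Finset.sum_filter, Finset.sum_const,
      ← Fintype.card_subtype, ← Nat.card_eq_fintype_card,
      ← Nat.card_congr (evenStabEquiv (rootLattice_stable b) σ ((M : ℝ)⁻¹ • β)), hrel,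
      nsmul_eq_mul, dualStabOrder]
    ring
  · rw [Finset.sum_eq_zero, mul_zero, mul_zero]
    intro u _
    rw [if_neg, mul_zero]
    intro h
    apply hββ
    -- A surviving u would carry β'/M to β/M by an element of the dual even affine group, with both
    -- points in its strict domain.
    have h2 := hD'.eq_of_mem (x := (M : ℝ)⁻¹ • β') (Subgroup.mem_map_of_mem _ u.2) h hβD'.1
      (by
        change u.1.1 _ + _ ∈ _
        rw [add_sub_cancel]
        exact hβD.1)
    change u.1.1 _ + _ = _ at h2
    rw [add_sub_cancel] at h2
    exact smul_right_injective V (inv_ne_zero hM') h2
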